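/- Let $B$ be a C*-algebra. Notation: $\Sigma B=\{f\in C([0,1],B): f(0)=f(1)=0\}$ is the suspension of $B$; $\Sigma=C_0(0,1)$ is identified with $\{\varphi\in C(S^1):\varphi(1)=0\}$, and $\omega\in\Sigma$ is the function $\omega(z)=z-1$. For a C*-algebra $C$, $C\otimes\mathcal K$ is its stabilisation, containing $\bigcup_k M_k(C)$ as a dense subalgebra (with $x\in M_k(C)$ identified with $\mathrm{diag}(x,0)\in M_{k+1}(C)$), and $\mathcal A_\delta C=C_b(\mathbb N;C)/C_0(\mathbb N;C)$. A discrete asymptotic homomorphism from $A$ to $C$ is a $*$-homomorphism $A\to\mathcal A_\delta C$. Two of them, $f_0$ and $f_1$, are asymptotically homotopic if there is a $*$-homomorphism $H\colon A\to\mathcal A_\delta\, C([0,1],C)$ with $\mathcal A_\delta\mathrm{ev}_i\circ H=f_i$ for $i=0,1$; the set of classes is denoted by $[[A,C]]_\delta$. $U_k^+(C)$ is the group of unitaries $u\in M_k(C_+)$ with $u-1\in M_k(C)$, where $C_+$ is the unitization of $C$, and $K_1(C)$ is the group of path components of $\bigcup_k U_k^+(C)$ (the union over $u\mapsto\mathrm{diag}(u,1)$).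 For every sequence $(u_n)_{n\in\mathbb N}$ in $\bigcup_k U_k^+(\Sigma B)$ there is a unique discrete asymptotic homomorphism $\tilde g_{(u_n)}\colon\Sigma\to\mathcal A_\delta(\Sigma B\otimes\mathcal K)$ with $\tilde g_{(u_n)}(\omega)=[n\mapsto u_n-1]$. Concatenation in the suspension coordinate of $\Sigma B$ makes $[[\Sigma,\Sigma B\otimes\mathcal K]]_\delta$ an abelian group with neutral element $[0]$. The map $$g_\delta^{\Sigma B}\colon\prod_{n\in\mathbb N}K_1(\Sigma B)\to[[\Sigma,\Sigma B\otimes\mathcal K]]_\delta,\qquad ([u_n])_{n\in\mathbb N}\mapsto[\tilde g_{(u_n)}],$$ is a well-defined surjective group homomorphism, and its kernel is $$\ker g_\delta^{\Sigma B}=\bigoplus_{n\in\mathbb N}K_1(\Sigma B),$$ the subgroup of all sequences $([u_n])_{n\in\mathbb N}$ which vanish eventually. -/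

import Mathlib

open Filter Topology
open scoped ENNReal

noncomputable section

namespace DTheory

/-! ### Bounded sequences modulo null sequences -/

section SeqAlg

variable (A : ℕ → Type*) [∀ n, NonUnitalCStarAlgebra (A n)]

/-- The ideal of bounded sequences `(aₙ)`, `aₙ ∈ Aₙ`, with `‖aₙ‖ → 0`. -/
def nullSeq : Submodule ℂ (lp A ∞) where
  carrier := {x | Tendsto (fun n => ‖x n‖) atTop (𝓝 0)}
  zero_mem' := by simp
  add_mem' {x y} hx hy := by
    refine squeeze_zero (fun n => norm_nonneg _) (fun n => norm_add_le (x n) (y n)) ?_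
    simpa using hx.add hy
  smul_mem' c x hx := by
    have : Tendsto (fun n => ‖c‖ * ‖x n‖) atTop (𝓝 0) := by
      simpa using Tendsto.const_mul ‖c‖ hx
    simpa [norm_smul] using this

variable {A}

theorem mem_nullSeq {x : lp A ∞} :
    x ∈ nullSeq A ↔ Tendsto (fun n => ‖x n‖) atTop (𝓝 0) := Iff.rfl

theorem norm_coe_le (x : lp A ∞) (n : ℕ) : ‖x n‖ ≤ ‖x‖ :=
  lp.norm_apply_le_norm ENNReal.top_ne_zero x n

theorem nullSeq_mul_left (x : lp A ∞) {y : lp A ∞} (hy : y ∈ nullSeq A) : x * y ∈ nullSeq A := by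
  refine squeeze_zero (fun n => norm_nonneg _) (fun n => ?_)
    (g := fun n => ‖x‖ * ‖y n‖) (by simpa using Tendsto.const_mul ‖x‖ (mem_nullSeq.1 hy))
  exact (norm_mul_le (x n) (y n)).trans (by gcongr; exact norm_coe_le x n)

theorem nullSeq_mul_right {x : lp A ∞} (hx : x ∈ nullSeq A) (y : lp A ∞) : x * y ∈ nullSeq A := by
  refine squeeze_zero (fun n => norm_nonneg _) (fun n => ?_)
    (g := fun n => ‖x n‖ * ‖y‖) (by simpa using Tendsto.mul_const ‖y‖ (mem_nullSeq.1 hx))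
  exact (norm_mul_le (x n) (y n)).trans (by gcongr; exact norm_coe_le y n)

theorem nullSeq_star {x : lp A ∞} (hx : x ∈ nullSeq A) : star x ∈ nullSeq A := by
  rw [mem_nullSeq] at hx ⊢
  simpa using hx

instance isClosed_nullSeq : IsClosed (nullSeq A : Set (lp A ∞)) := by
  refine isClosed_of_closure_subset fun x hx => ?_
  rw [SetLike.mem_coe, mem_nullSeq, Metric.tendsto_atTop]
  intro ε hε
  obtain ⟨y, hy, hxy⟩ := Metric.mem_closure_iff.1 hx (ε / 2) (half_pos hε)
  obtain ⟨N, hN⟩ := Metric.tendsto_atTop.1 (mem_nullSeq.1 hy) (ε / 2) (half_pos hε)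
  refine ⟨N, fun n hn => ?_⟩
  have h1 := hN n hn
  rw [Real.dist_eq, sub_zero, abs_norm] at h1 ⊢
  have h2 : ‖x n - y n‖ < ε / 2 := by
    rw [dist_eq_norm] at hxy
    exact (norm_coe_le (x - y) n).trans_lt hxy
  calc ‖x n‖ = ‖(x n - y n) + y n‖ := by rw [sub_add_cancel]
    _ ≤ ‖x n - y n‖ + ‖y n‖ := norm_add_le _ _
    _ < ε := by linarith

variable (A) in
/-- The quotient C*-algebra `∏ₙ Aₙ / ⨁ₙ Aₙ` of bounded sequences modulo null sequences. -/
def SeqAlg : Type _ := lp A ∞ ⧸ nullSeq A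

namespace SeqAlg

instance : NormedAddCommGroup (SeqAlg A) :=
  inferInstanceAs (NormedAddCommGroup (lp A ∞ ⧸ nullSeq A))

instance : NormedSpace ℂ (SeqAlg A) :=
  inferInstanceAs (NormedSpace ℂ (lp A ∞ ⧸ nullSeq A))

instance : CompleteSpace (SeqAlg A) :=
  inferInstanceAs (CompleteSpace (lp A ∞ ⧸ nullSeq A))

/-- The class of a bounded sequence. -/
def cls : lp A ∞ →ₗ[ℂ] SeqAlg A := (nullSeq A).mkQ

theorem cls_surjective : Function.Surjective (cls (A := A)) := (nullSeq A).mkQ_surjective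

theorem cls_eq_iff {x y : lp A ∞} : cls x = cls y ↔ x - y ∈ nullSeq A :=
  Submodule.Quotient.eq _

instance : Mul (SeqAlg A) where
  mul := Quotient.map₂ (· * ·) (by
    intro a b hab c d hcd
    have h1 : a - b ∈ nullSeq A := (Submodule.quotientRel_def _).1 hab
    have h2 : c - d ∈ nullSeq A := (Submodule.quotientRel_def _).1 hcd
    refine (Submodule.quotientRel_def _).2 ?_
    have : a * c - b * d = (a - b) * c + b * (c - d) := by noncomm_ring
    rw [this]
    exact add_mem (nullSeq_mul_right h1 _) (nullSeq_mul_left _ h2))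

instance : Star (SeqAlg A) where
  star := Quotient.map star (by
    intro a b hab
    have h1 : a - b ∈ nullSeq A := (Submodule.quotientRel_def _).1 hab
    refine (Submodule.quotientRel_def _).2 ?_
    rw [← star_sub]
    exact nullSeq_star h1)

theorem cls_mul (x y : lp A ∞) : cls (x * y) = cls x * cls y := rfl

theorem cls_star (x : lp A ∞) : cls (star x) = star (cls x) := rfl

instance : NonUnitalRing (SeqAlg A) where
  __ := (inferInstance : AddCommGroup (SeqAlg A))
  left_distrib a b c := by
    obtain ⟨a, rfl⟩ := cls_surjective a
    obtain ⟨b, rfl⟩ := cls_surjective b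
    obtain ⟨c, rfl⟩ := cls_surjective c
    simp only [← map_add, ← cls_mul, mul_add]
  right_distrib a b c := by
    obtain ⟨a, rfl⟩ := cls_surjective a
    obtain ⟨b, rfl⟩ := cls_surjective b
    obtain ⟨c, rfl⟩ := cls_surjective c
    simp only [← map_add, ← cls_mul, add_mul]
  zero_mul a := by
    obtain ⟨a, rfl⟩ := cls_surjective a
    rw [← map_zero (cls (A := A)), ← cls_mul, zero_mul]
  mul_zero a := by
    obtain ⟨a, rfl⟩ := cls_surjective a
    rw [← map_zero (cls (A := A)), ← cls_mul, mul_zero]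
  mul_assoc a b c := by
    obtain ⟨a, rfl⟩ := cls_surjective a
    obtain ⟨b, rfl⟩ := cls_surjective b
    obtain ⟨c, rfl⟩ := cls_surjective c
    simp only [← cls_mul, mul_assoc]

instance : StarRing (SeqAlg A) where
  star_involutive a := by
    obtain ⟨a, rfl⟩ := cls_surjective a
    simp only [← cls_star, star_star]
  star_mul a b := by
    obtain ⟨a, rfl⟩ := cls_surjective a
    obtain ⟨b, rfl⟩ := cls_surjective b
    simp only [← cls_star, ← cls_mul, star_mul]
  star_add a b := by
    obtain ⟨a, rfl⟩ := cls_surjective a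
    obtain ⟨b, rfl⟩ := cls_surjective b
    simp only [← cls_star, ← map_add, star_add]

theorem norm_cls_le (x : lp A ∞) : ‖cls x‖ ≤ ‖x‖ := Submodule.Quotient.norm_mk_le _ x

theorem exists_cls_norm_lt (q : SeqAlg A) {ε : ℝ} (hε : 0 < ε) :
    ∃ x : lp A ∞, cls x = q ∧ ‖x‖ < ‖q‖ + ε :=
  Submodule.Quotient.norm_mk_lt (S := nullSeq A) q hε

/-- The norm of a class is bounded by any eventual bound of a representing sequence. -/
theorem norm_cls_le_of_eventually (x : lp A ∞) {C : ℝ} (hC : 0 ≤ C)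
    (h : ∀ᶠ n in atTop, ‖x n‖ ≤ C) : ‖cls x‖ ≤ C := by
  obtain ⟨N, hN⟩ := eventually_atTop.1 h
  let f : ∀ n, A n := fun n => if n < N then 0 else x n
  have hf : ∀ n, ‖f n‖ ≤ C := fun n => by
    by_cases hn : n < N
    · simpa [f, hn] using hC
    · simpa [f, hn] using hN n (not_lt.1 hn)
  let y : lp A ∞ := ⟨f, memℓp_infty ⟨C, by rintro _ ⟨n, rfl⟩; exact hf n⟩⟩
  have hxy : cls x = cls y := by
    rw [cls_eq_iff, mem_nullSeq]
    refine tendsto_const_nhds.congr' ?_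
    filter_upwards [eventually_ge_atTop N] with n hn
    have : y n = x n := by simp [y, f, not_lt.2 hn]
    rw [lp.coeFn_sub, Pi.sub_apply, this, sub_self, norm_zero]
  rw [hxy]
  exact (norm_cls_le y).trans (lp.norm_le_of_forall_le hC hf)

instance : NonUnitalNormedRing (SeqAlg A) where
  __ := (inferInstance : NormedAddCommGroup (SeqAlg A))
  __ := (inferInstance : NonUnitalRing (SeqAlg A))
  norm_mul_le p q := by
    refine le_of_forall_pos_lt_add fun ε hε => ?_
    have hcont : Tendsto (fun δ : ℝ => (‖p‖ + δ) * (‖q‖ + δ)) (𝓝[>] 0) (𝓝 (‖p‖ * ‖q‖)) := by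
      have : Continuous fun δ : ℝ => (‖p‖ + δ) * (‖q‖ + δ) := by fun_prop
      simpa using (this.tendsto 0).mono_left nhdsWithin_le_nhds
    obtain ⟨δ, hδ, hδ0⟩ := ((hcont.eventually (gt_mem_nhds
      (lt_add_of_pos_right (‖p‖ * ‖q‖) hε))).and self_mem_nhdsWithin).exists
    obtain ⟨x, rfl, hx⟩ := exists_cls_norm_lt p hδ0
    obtain ⟨y, rfl, hy⟩ := exists_cls_norm_lt q hδ0
    calc ‖cls x * cls y‖ = ‖cls (x * y)‖ := by rw [cls_mul]
      _ ≤ ‖x * y‖ := norm_cls_le _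
      _ ≤ ‖x‖ * ‖y‖ := norm_mul_le _ _
      _ ≤ (‖cls x‖ + δ) * (‖cls y‖ + δ) := by gcongr
      _ < _ := hδ

instance : CStarRing (SeqAlg A) where
  norm_mul_self_le q := by
    refine le_of_forall_pos_le_add fun ε hε => ?_
    obtain ⟨x, rfl⟩ := cls_surjective q
    obtain ⟨y, hy, hyn⟩ := exists_cls_norm_lt (star (cls x) * cls x) (half_pos hε)
    rw [← cls_star, ← cls_mul, cls_eq_iff, mem_nullSeq] at hy
    have hC : 0 ≤ ‖star (cls x) * cls x‖ + ε := by positivity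
    have key : ‖cls x‖ ≤ √(‖star (cls x) * cls x‖ + ε) := by
      refine norm_cls_le_of_eventually x (Real.sqrt_nonneg _) ?_
      filter_upwards [hy.eventually (gt_mem_nhds (half_pos hε))] with n hn
      refine Real.le_sqrt_of_sq_le ?_
      have h1 : ‖x n‖ ^ 2 = ‖(star x * x) n‖ := by
        rw [lp.infty_coeFn_mul, Pi.mul_apply, lp.star_apply, CStarRing.norm_star_mul_self, sq]
      have h2 : (star x * x) n = y n - (y - star x * x) n := by
        rw [lp.coeFn_sub, Pi.sub_apply]; abel
      rw [h1, h2]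
      have h3 := norm_sub_le (y n) ((y - star x * x) n)
      have h4 := norm_coe_le y n
      linarith
    calc ‖cls x‖ * ‖cls x‖ ≤ √(‖star (cls x) * cls x‖ + ε) * √(‖star (cls x) * cls x‖ + ε) := by
          gcongr
      _ = _ := Real.mul_self_sqrt hC

instance : NonUnitalCStarAlgebra (SeqAlg A) where
  smul_assoc c p q := by
    obtain ⟨x, rfl⟩ := cls_surjective p
    obtain ⟨y, rfl⟩ := cls_surjective q
    simp only [smul_eq_mul, ← map_smul, ← cls_mul, smul_mul_assoc]
  smul_comm c p q := by
    obtain ⟨x, rfl⟩ := cls_surjective p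
    obtain ⟨y, rfl⟩ := cls_surjective q
    simp only [smul_eq_mul, ← map_smul, ← cls_mul, mul_smul_comm]
  star_smul c p := by
    obtain ⟨x, rfl⟩ := cls_surjective p
    simp only [← cls_star, ← map_smul, star_smul]

variable {A' : ℕ → Type*} [∀ n, NonUnitalCStarAlgebra (A' n)]

/-- The termwise image of a bounded sequence under a sequence of *-homomorphisms. -/
def mapSeq (f : ∀ n, A n →⋆ₙₐ[ℂ] A' n) (x : lp A ∞) : lp A' ∞ :=
  ⟨fun n => f n (x n), memℓp_infty ⟨‖x‖, by
    rintro _ ⟨n, rfl⟩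
    exact (NonUnitalStarAlgHom.norm_apply_le (f n) (x n)).trans (norm_coe_le x n)⟩⟩

@[simp] theorem mapSeq_apply (f : ∀ n, A n →⋆ₙₐ[ℂ] A' n) (x : lp A ∞) (n : ℕ) :
    mapSeq f x n = f n (x n) := rfl

/-- Functoriality: a sequence of *-homomorphisms `fₙ : Aₙ → A'ₙ` induces the *-homomorphism
`[n ↦ xₙ] ↦ [n ↦ fₙ(xₙ)]`. -/
def map (f : ∀ n, A n →⋆ₙₐ[ℂ] A' n) : SeqAlg A →⋆ₙₐ[ℂ] SeqAlg A' where
  toFun := Quotient.map (mapSeq f) (by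
    intro x y hxy
    have h1 : x - y ∈ nullSeq A := (Submodule.quotientRel_def _).1 hxy
    refine (Submodule.quotientRel_def _).2 ?_
    rw [mem_nullSeq] at h1 ⊢
    refine squeeze_zero (fun n => norm_nonneg _) (fun n => ?_) h1
    have : (mapSeq f x - mapSeq f y) n = f n ((x - y) n) := by
      simp
    rw [this]
    exact NonUnitalStarAlgHom.norm_apply_le (f n) _)
  map_smul' c p := by
    obtain ⟨x, rfl⟩ := cls_surjective p
    refine congrArg cls (show mapSeq f (c • x) = c • mapSeq f x from lp.ext (funext fun n => ?_))
    simp [lp.coeFn_smul]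
  map_zero' :=
    congrArg cls (show mapSeq f 0 = 0 from lp.ext (funext fun n => by simp))
  map_add' p q := by
    obtain ⟨x, rfl⟩ := cls_surjective p
    obtain ⟨y, rfl⟩ := cls_surjective q
    refine congrArg cls (show mapSeq f (x + y) = mapSeq f x + mapSeq f y from
      lp.ext (funext fun n => ?_))
    simp
  map_mul' p q := by
    obtain ⟨x, rfl⟩ := cls_surjective p
    obtain ⟨y, rfl⟩ := cls_surjective q
    refine congrArg cls (show mapSeq f (x * y) = mapSeq f x * mapSeq f y from
      lp.ext (funext fun n => ?_))
    simp [lp.infty_coeFn_mul]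
  map_star' p := by
    obtain ⟨x, rfl⟩ := cls_surjective p
    refine congrArg cls (show mapSeq f (star x) = star (mapSeq f x) from
      lp.ext (funext fun n => ?_))
    simp [lp.star_apply, map_star]

theorem map_cls (f : ∀ n, A n →⋆ₙₐ[ℂ] A' n) (x : lp A ∞) : map f (cls x) = cls (mapSeq f x) := rfl

end SeqAlg

end SeqAlg

/-! ### Matrix algebras and the stabilisation `B ⊗ 𝒦` -/

section Matrices

/-- The matrix algebra `M_k(B)`. -/
def Mat (k : ℕ) (B : Type*) : Type _ := CStarMatrix (Fin k) (Fin k) B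

/-- `M_k(B)` with its C*-norm. (The norm of `CStarMatrix` does not depend on the order, which is
only a parameter of Mathlib's instance.) -/
instance (k : ℕ) (B : Type*) [NonUnitalCStarAlgebra B] : NonUnitalCStarAlgebra (Mat k B) :=
  letI := CStarAlgebra.spectralOrder B
  letI := CStarAlgebra.spectralOrderedRing B
  inferInstanceAs (NonUnitalCStarAlgebra (CStarMatrix (Fin k) (Fin k) B))

/-- The corner embedding `x ↦ diag(x, 0)` from `k × k` to `n × n` matrices if `k ≤ n`
(and the upper left `n × n` corner of `x` if `n < k`). -/
def pad {R : Type*} [Zero R] (k n : ℕ) (x : CStarMatrix (Fin k) (Fin k) R) :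
    CStarMatrix (Fin n) (Fin n) R :=
  CStarMatrix.ofMatrix fun i j =>
    if h : (i : ℕ) < k ∧ (j : ℕ) < k then x ⟨i, h.1⟩ ⟨j, h.2⟩ else 0

theorem pad_apply {R : Type*} [Zero R] (k n : ℕ) (x : CStarMatrix (Fin k) (Fin k) R)
    (i j : Fin n) :
    pad k n x i j = if h : (i : ℕ) < k ∧ (j : ℕ) < k then x ⟨i, h.1⟩ ⟨j, h.2⟩ else 0 := rfl

theorem pad_mul {R : Type*} [NonUnitalNonAssocSemiring R] {k n : ℕ} (h : k ≤ n)
    (x y : CStarMatrix (Fin k) (Fin k) R) : pad k n (x * y) = pad k n x * pad k n y := by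
  refine CStarMatrix.ext fun i j => ?_
  rw [CStarMatrix.mul_apply]
  by_cases hij : (i : ℕ) < k ∧ (j : ℕ) < k
  · rw [pad_apply, dif_pos hij, CStarMatrix.mul_apply]
    refine Fintype.sum_of_injective (Fin.castLE h) (Fin.castLE_injective h) _ _ ?_ ?_
    · intro l hl
      have : ¬ (l : ℕ) < k := fun hlk => hl ⟨⟨l, hlk⟩, rfl⟩
      simp [pad_apply, this]
    · intro l
      simp [pad_apply, hij.1, hij.2]
  · rw [pad_apply, dif_neg hij]
    refine (Finset.sum_eq_zero fun l _ => ?_).symm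
    by_cases hi : (i : ℕ) < k
    · have hj : ¬ (j : ℕ) < k := fun hj => hij ⟨hi, hj⟩
      simp [pad_apply, hj]
    · simp [pad_apply, hi]

theorem pad_star {R : Type*} [AddMonoid R] [StarAddMonoid R] (k n : ℕ)
    (x : CStarMatrix (Fin k) (Fin k) R) : pad k n (star x) = star (pad k n x) := by
  refine CStarMatrix.ext fun i j => ?_
  by_cases hij : (i : ℕ) < k ∧ (j : ℕ) < k
  · simp [pad_apply, CStarMatrix.star_apply, hij]
  · have hji : ¬ ((j : ℕ) < k ∧ (i : ℕ) < k) := fun h => hij h.symm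
    simp [pad_apply, CStarMatrix.star_apply, hij, hji]

theorem pad_add {R : Type*} [AddMonoid R] (k n : ℕ)
    (x y : CStarMatrix (Fin k) (Fin k) R) : pad k n (x + y) = pad k n x + pad k n y := by
  refine CStarMatrix.ext fun i j => ?_
  by_cases hij : (i : ℕ) < k ∧ (j : ℕ) < k <;> simp [pad_apply, hij]

theorem pad_smul {R : Type*} [AddMonoid R] [DistribMulAction ℂ R] (k n : ℕ) (c : ℂ)
    (x : CStarMatrix (Fin k) (Fin k) R) : pad k n (c • x) = c • pad k n x := by
  refine CStarMatrix.ext fun i j => ?_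
  by_cases hij : (i : ℕ) < k ∧ (j : ℕ) < k <;> simp [pad_apply, hij]

theorem pad_pad {R : Type*} [Zero R] {k l : ℕ} (n : ℕ) (h : k ≤ l)
    (x : CStarMatrix (Fin k) (Fin k) R) : pad l n (pad k l x) = pad k n x := by
  refine CStarMatrix.ext fun i j => ?_
  by_cases hij : (i : ℕ) < k ∧ (j : ℕ) < k
  · have : (i : ℕ) < l ∧ (j : ℕ) < l := ⟨hij.1.trans_le h, hij.2.trans_le h⟩
    simp [pad_apply, hij, this]
  · simp [pad_apply, hij]

theorem pad_self {R : Type*} [Zero R] (k : ℕ) (x : CStarMatrix (Fin k) (Fin k) R) :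
    pad k k x = x := by
  refine CStarMatrix.ext fun i j => ?_
  simp [pad_apply]

theorem pad_pad_of_le {R : Type*} [Zero R] {k n : ℕ} (h : k ≤ n)
    (x : CStarMatrix (Fin k) (Fin k) R) : pad n k (pad k n x) = x := by
  rw [pad_pad k h, pad_self]

end Matrices

section Stabilisation

variable {B : Type*} [NonUnitalCStarAlgebra B]

/-- The corner embedding `M_k(B) → M_n(B)` as a *-homomorphism, for `k ≤ n`. -/
def padHom {k n : ℕ} (h : k ≤ n) : Mat k B →⋆ₙₐ[ℂ] Mat n B where
  toFun := pad k n
  map_smul' c x := pad_smul k n c x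
  map_zero' := CStarMatrix.ext fun i j => by
    change (if h : (i : ℕ) < k ∧ (j : ℕ) < k then (0 : B) else 0) = 0
    simp
  map_add' x y := pad_add k n x y
  map_mul' x y := pad_mul h x y
  map_star' x := pad_star k n x

variable (B) in
/-- The sequence `(0, …, 0, x, diag(x,0), diag(x,0,0), …)` in `∏ₙ M_n(B)`, for `x ∈ M_k(B)`. -/
def cornerSeq (k : ℕ) (x : Mat k B) : lp (fun n => Mat n B) ∞ :=
  ⟨fun n => if h : k ≤ n then padHom h x else 0, memℓp_infty ⟨‖x‖, by
    rintro _ ⟨n, rfl⟩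
    by_cases h : k ≤ n
    · simpa [h] using NonUnitalStarAlgHom.norm_apply_le (padHom (B := B) h) x
    · simp [h]⟩⟩

theorem cornerSeq_apply (k : ℕ) (x : Mat k B) (n : ℕ) :
    cornerSeq B k x n = if h : k ≤ n then padHom h x else 0 := rfl

variable (B) in
/-- The *-homomorphism `M_k(B) → ∏ₙ M_n(B) / ⨁ₙ M_n(B)`, `x ↦ [n ↦ diag(x, 0_{n-k})]`. -/
def cornerHom (k : ℕ) : Mat k B →⋆ₙₐ[ℂ] SeqAlg (fun n => Mat n B) where
  toFun x := SeqAlg.cls (cornerSeq B k x)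
  map_smul' c x := by
    refine congrArg SeqAlg.cls
      (show cornerSeq B k (c • x) = c • cornerSeq B k x from lp.ext (funext fun n => ?_))
    rw [lp.coeFn_smul, Pi.smul_apply]
    by_cases h : k ≤ n <;> simp [cornerSeq_apply, h, map_smul]
  map_zero' := congrArg SeqAlg.cls (show cornerSeq B k 0 = 0 from lp.ext (funext fun n => by
    by_cases h : k ≤ n <;> simp [cornerSeq_apply, h]))
  map_add' x y := by
    refine congrArg SeqAlg.cls
      (show cornerSeq B k (x + y) = cornerSeq B k x + cornerSeq B k y from
        lp.ext (funext fun n => ?_))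
    rw [lp.coeFn_add, Pi.add_apply]
    by_cases h : k ≤ n <;> simp [cornerSeq_apply, h, map_add]
  map_mul' x y := by
    refine congrArg SeqAlg.cls
      (show cornerSeq B k (x * y) = cornerSeq B k x * cornerSeq B k y from
        lp.ext (funext fun n => ?_))
    rw [lp.infty_coeFn_mul, Pi.mul_apply]
    by_cases h : k ≤ n <;> simp [cornerSeq_apply, h, map_mul]
  map_star' x := by
    refine congrArg SeqAlg.cls
      (show cornerSeq B k (star x) = star (cornerSeq B k x) from lp.ext (funext fun n => ?_))
    rw [lp.star_apply]
    by_cases h : k ≤ n <;> simp [cornerSeq_apply, h, map_star]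

theorem cornerHom_padHom {k l : ℕ} (h : k ≤ l) (x : Mat k B) :
    cornerHom B l (padHom h x) = cornerHom B k x := by
  refine SeqAlg.cls_eq_iff.2 (mem_nullSeq.2 (tendsto_const_nhds.congr' ?_))
  filter_upwards [eventually_ge_atTop l] with n hn
  rw [lp.coeFn_sub, Pi.sub_apply, cornerSeq_apply, cornerSeq_apply, dif_pos hn,
    dif_pos (h.trans hn)]
  have : padHom hn (padHom h x) = padHom (h.trans hn) x := pad_pad n h x
  rw [this, sub_self, norm_zero]

variable (B) in
/-- `⋃_k M_k(B)`, the union over the corner embeddings `x ↦ diag(x, 0)`. -/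
def matUnion : NonUnitalStarSubalgebra ℂ (SeqAlg (fun n => Mat n B)) where
  carrier := ⋃ k, Set.range (cornerHom B k)
  zero_mem' := Set.mem_iUnion.2 ⟨0, 0, map_zero _⟩
  add_mem' := by
    intro a b ha hb
    obtain ⟨k, x, rfl⟩ := Set.mem_iUnion.1 ha
    obtain ⟨l, y, rfl⟩ := Set.mem_iUnion.1 hb
    refine Set.mem_iUnion.2 ⟨max k l,
      padHom (le_max_left k l) x + padHom (le_max_right k l) y, ?_⟩
    rw [map_add, cornerHom_padHom, cornerHom_padHom]
  mul_mem' := by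
    intro a b ha hb
    obtain ⟨k, x, rfl⟩ := Set.mem_iUnion.1 ha
    obtain ⟨l, y, rfl⟩ := Set.mem_iUnion.1 hb
    refine Set.mem_iUnion.2 ⟨max k l,
      padHom (le_max_left k l) x * padHom (le_max_right k l) y, ?_⟩
    rw [map_mul, cornerHom_padHom, cornerHom_padHom]
  smul_mem' := by
    intro c a ha
    obtain ⟨k, x, rfl⟩ := Set.mem_iUnion.1 ha
    exact Set.mem_iUnion.2 ⟨k, c • x, map_smul _ c x⟩
  star_mem' := by
    intro a ha
    obtain ⟨k, x, rfl⟩ := Set.mem_iUnion.1 ha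
    exact Set.mem_iUnion.2 ⟨k, star x, map_star _ x⟩

variable (B) in
/-- The stabilisation `B ⊗ 𝒦`: since `𝒦 = 𝒦(ℓ²)` is the C*-inductive limit of the matrix algebras
`M_k(ℂ)`, it is the C*-inductive limit of `M_1(B) → M_2(B) → ⋯` along the corner embeddings
`x ↦ diag(x, 0)`. As usual, this limit is realised as the closure of the union `⋃_k M_k(B)`
inside `∏ₙ M_n(B) / ⨁ₙ M_n(B)`. -/
def Stab : Type _ := (matUnion B).topologicalClosure

instance : NonUnitalCStarAlgebra (Stab B) :=
  haveI : IsClosed ((matUnion B).topologicalClosure : Set (SeqAlg (fun n => Mat n B))) :=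
    (matUnion B).isClosed_topologicalClosure
  inferInstanceAs (NonUnitalCStarAlgebra (matUnion B).topologicalClosure)

namespace Stab

/-- The inclusion `M_k(B) ⊂ B ⊗ 𝒦`. -/
def incl (k : ℕ) : Mat k B →⋆ₙₐ[ℂ] Stab B :=
  NonUnitalStarAlgHom.codRestrict (cornerHom B k) (matUnion B).topologicalClosure
    fun x => (matUnion B).le_topologicalClosure (Set.mem_iUnion.2 ⟨k, x, rfl⟩)

theorem padHom_injective {k n : ℕ} (h : k ≤ n) : Function.Injective (padHom (B := B) h) := by
  intro x y hxy
  have key : pad n k (pad k n (x : CStarMatrix (Fin k) (Fin k) B)) =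
      pad n k (pad k n (y : CStarMatrix (Fin k) (Fin k) B)) :=
    congrArg (fun z : Mat n B => pad n k z) hxy
  refine CStarMatrix.ext fun i j => ?_
  exact congrFun (congrFun ((pad_pad_of_le h _).symm.trans (key.trans (pad_pad_of_le h _))) i) j

/-- The inclusions `M_k(B) ⊂ B ⊗ 𝒦` are isometric. -/
theorem norm_incl (k : ℕ) (x : Mat k B) : ‖incl k x‖ = ‖x‖ := by
  refine NonUnitalStarAlgHom.norm_map _ ?_ x
  rw [injective_iff_map_eq_zero]
  intro y hy
  have h1 : SeqAlg.cls (cornerSeq B k y) = SeqAlg.cls 0 := by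
    rw [map_zero]; exact congrArg Subtype.val hy
  rw [SeqAlg.cls_eq_iff, sub_zero, mem_nullSeq] at h1
  have h2 : Tendsto (fun _ : ℕ => ‖y‖) atTop (𝓝 0) := by
    refine h1.congr' ?_
    filter_upwards [eventually_ge_atTop k] with n hn
    rw [cornerSeq_apply, dif_pos hn]
    exact NonUnitalStarAlgHom.norm_map _ (padHom_injective hn) y
  exact norm_eq_zero.1 (tendsto_nhds_unique tendsto_const_nhds h2)

variable {C : Type*} [NonUnitalCStarAlgebra C]

/-- Entrywise application of a *-homomorphism, `M_k(B) → M_k(C)`. -/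
def matMap (f : B →⋆ₙₐ[ℂ] C) (k : ℕ) : Mat k B →⋆ₙₐ[ℂ] Mat k C :=
  CStarMatrix.mapₙₐ (n := Fin k) f

theorem matMap_apply (f : B →⋆ₙₐ[ℂ] C) (k : ℕ) (x : Mat k B) (i j : Fin k) :
    (matMap f k x : CStarMatrix (Fin k) (Fin k) C) i j =
      f ((x : CStarMatrix (Fin k) (Fin k) B) i j) := rfl

theorem map_cornerHom (f : B →⋆ₙₐ[ℂ] C) (k : ℕ) (x : Mat k B) :
    SeqAlg.map (matMap f) (cornerHom B k x) = cornerHom C k (matMap f k x) := by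
  refine congrArg SeqAlg.cls (lp.ext (funext fun n => ?_))
  rw [SeqAlg.mapSeq_apply, cornerSeq_apply, cornerSeq_apply]
  by_cases h : k ≤ n
  · rw [dif_pos h, dif_pos h]
    refine CStarMatrix.ext fun i j => ?_
    change f (if h : (i : ℕ) < k ∧ (j : ℕ) < k then _ else 0) =
      if h : (i : ℕ) < k ∧ (j : ℕ) < k then _ else 0
    split_ifs
    · rfl
    · exact map_zero f
  · rw [dif_neg h, dif_neg h, map_zero]

theorem map_mem (f : B →⋆ₙₐ[ℂ] C) {x : SeqAlg (fun n => Mat n B)}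
    (hx : x ∈ (matUnion B).topologicalClosure) :
    SeqAlg.map (matMap f) x ∈ (matUnion C).topologicalClosure := by
  have hc : Continuous (SeqAlg.map (matMap f)) :=
    AddMonoidHomClass.continuous_of_bound (SeqAlg.map (matMap f)) 1 fun a => by
      simpa using NonUnitalStarAlgHom.norm_apply_le (SeqAlg.map (matMap f)) a
  refine map_mem_closure hc hx fun a ha => ?_
  obtain ⟨k, y, rfl⟩ := Set.mem_iUnion.1 ha
  exact Set.mem_iUnion.2 ⟨k, matMap f k y, (map_cornerHom f k y).symm⟩

/-- Functoriality of the stabilisation: `f ⊗ id : B ⊗ 𝒦 → C ⊗ 𝒦`, the *-homomorphism which on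
`M_k(B)` is the entrywise application of `f`. -/
def map (f : B →⋆ₙₐ[ℂ] C) : Stab B →⋆ₙₐ[ℂ] Stab C :=
  NonUnitalStarAlgHom.codRestrict
    ((SeqAlg.map (matMap f)).comp
      (NonUnitalStarSubalgebraClass.subtype (matUnion B).topologicalClosure))
    (matUnion C).topologicalClosure fun x => map_mem f x.2

theorem map_incl (f : B →⋆ₙₐ[ℂ] C) (k : ℕ) (x : Mat k B) :
    map f (incl k x) = incl k (matMap f k x) :=
  Subtype.ext (map_cornerHom f k x)

/-- `⋃_k M_k(B)` is dense in `B ⊗ 𝒦`. -/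
theorem dense_incl : Dense (⋃ k, Set.range (incl (B := B) k)) := by
  intro x
  have hx : (x.1 : SeqAlg (fun n => Mat n B)) ∈ closure (matUnion B : Set _) := x.2
  rw [Metric.mem_closure_iff] at hx ⊢
  intro ε hε
  obtain ⟨y, hy, hxy⟩ := hx ε hε
  obtain ⟨k, z, rfl⟩ := Set.mem_iUnion.1 hy
  exact ⟨incl k z, Set.mem_iUnion.2 ⟨k, z, rfl⟩, hxy⟩

end Stab

end Stabilisation

/-! ### Unitaries and `K₁` -/

section KTheory

variable (B : Type*) [NonUnitalCStarAlgebra B]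

/-- The `k × k` matrices over the unitization `B₊` of `B`. -/
abbrev UMat (k : ℕ) : Type _ := CStarMatrix (Fin k) (Fin k) (Unitization ℂ B)

/-- `U_k⁺(B)` as a subgroup of the unitary group of `M_k(B₊)`. -/
def uPlusSubgroup (k : ℕ) : Subgroup (unitary (UMat B k)) where
  carrier := {u | ∀ i j, (((u : UMat B k) - 1) i j).fst = 0}
  one_mem' i j := by simp
  mul_mem' {u v} hu hv i j := by
    have : ((u * v : unitary (UMat B k)) : UMat B k) - 1 =
        ((u : UMat B k) - 1) * ((v : UMat B k) - 1) + ((u : UMat B k) - 1) +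
          ((v : UMat B k) - 1) := by
      rw [Submonoid.coe_mul]; noncomm_ring
    rw [this, CStarMatrix.add_apply, CStarMatrix.add_apply, Unitization.fst_add,
      Unitization.fst_add, hu i j, hv i j, add_zero, add_zero, CStarMatrix.mul_apply]
    have hsum : ∀ s : Fin k → Unitization ℂ B, (∑ l, s l).fst = ∑ l, (s l).fst :=
      fun s => map_sum (Unitization.fstHom ℂ B) s Finset.univ
    rw [hsum]
    exact Finset.sum_eq_zero fun l _ => by rw [Unitization.fst_mul, hu i l, zero_mul]
  inv_mem' {u} hu i j := by
    have h1 : ((u⁻¹ : unitary (UMat B k)) : UMat B k) - 1 = star ((u : UMat B k) - 1) := by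
      rw [star_sub, star_one]; rfl
    rw [h1, CStarMatrix.star_apply, Unitization.fst_star, hu j i, star_zero]

/-- The group `U_k⁺(B)` of unitaries `u ∈ M_k(B₊)` with `u - 1 ∈ M_k(B)`, i.e. such that all
entries of `u - 1` have scalar part zero. -/
def UPlus (k : ℕ) : Type _ := uPlusSubgroup B k

instance (k : ℕ) : Group (UPlus B k) := inferInstanceAs (Group (uPlusSubgroup B k))

variable {B}

namespace UPlus

/-- The underlying matrix over `B₊`. -/
def val {k : ℕ} (u : UPlus B k) : UMat B k := u.1.1

theorem val_injective {k : ℕ} : Function.Injective (val (B := B) (k := k)) :=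
  fun _ _ h => Subtype.ext (Subtype.ext h)

theorem val_one {k : ℕ} : val (1 : UPlus B k) = 1 := rfl

theorem val_mul {k : ℕ} (u v : UPlus B k) : val (u * v) = val u * val v := rfl

theorem star_val_mul {k : ℕ} (u : UPlus B k) : star (val u) * val u = 1 :=
  (Unitary.mem_iff.1 u.1.2).1

theorem val_mul_star {k : ℕ} (u : UPlus B k) : val u * star (val u) = 1 :=
  (Unitary.mem_iff.1 u.1.2).2

theorem val_inv {k : ℕ} (u : UPlus B k) : val u⁻¹ = star (val u) := rfl

/-- For `u ∈ U_k⁺(B)` and `k ≤ n`, the unitary `diag(u, 1) = 1 + diag(u - 1, 0) ∈ U_n⁺(B)`. -/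
def stab {k n : ℕ} (h : k ≤ n) : UPlus B k →* UPlus B n where
  toFun u := ⟨⟨1 + pad k n (val u - 1), by
      rw [Unitary.mem_iff, star_add, star_one, ← pad_star]
      have h1 : star (val u - 1) + (val u - 1) + star (val u - 1) * (val u - 1) = 0 := by
        rw [star_sub, star_one]
        have : star (val u) - 1 + (val u - 1) + (star (val u) - 1) * (val u - 1) =
          star (val u) * val u - 1 := by noncomm_ring
        rw [this, star_val_mul, sub_self]
      have h2 : (val u - 1) + star (val u - 1) + (val u - 1) * star (val u - 1) = 0 := by
        rw [star_sub, star_one]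
        have : (val u - 1) + (star (val u) - 1) + (val u - 1) * (star (val u) - 1) =
          val u * star (val u) - 1 := by noncomm_ring
        rw [this, val_mul_star, sub_self]
      have hz : pad k n (0 : UMat B k) = 0 := CStarMatrix.ext fun i j => by simp [pad_apply]
      constructor
      · have := congrArg (pad k n) h1
        rw [pad_add, pad_add, pad_mul h, hz] at this
        calc _ = 1 + (pad k n (star (val u - 1)) + pad k n (val u - 1) +
              pad k n (star (val u - 1)) * pad k n (val u - 1)) := by noncomm_ring
          _ = 1 := by rw [this, add_zero]
      · have := congrArg (pad k n) h2
        rw [pad_add, pad_add, pad_mul h, hz] at this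
        calc _ = 1 + (pad k n (val u - 1) + pad k n (star (val u - 1)) +
              pad k n (val u - 1) * pad k n (star (val u - 1))) := by noncomm_ring
          _ = 1 := by rw [this, add_zero]⟩, fun i j => by
      change ((1 + pad k n (val u - 1) - 1 : UMat B n) i j).fst = 0
      rw [add_sub_cancel_left, pad_apply]
      split_ifs
      · exact u.2 _ _
      · rfl⟩
  map_one' := by
    refine val_injective ?_
    change 1 + pad k n (1 - 1) = (1 : UMat B n)
    rw [sub_self]
    refine CStarMatrix.ext fun i j => ?_
    simp [pad_apply]
  map_mul' u v := by
    refine val_injective ?_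
    change 1 + pad k n (val u * val v - 1) = (1 + pad k n (val u - 1)) * (1 + pad k n (val v - 1))
    have : val u * val v - 1 = (val u - 1) + (val v - 1) + (val u - 1) * (val v - 1) := by
      noncomm_ring
    rw [this, pad_add, pad_add, pad_mul h]
    noncomm_ring

theorem val_stab {k n : ℕ} (h : k ≤ n) (u : UPlus B k) :
    val (stab h u) = 1 + pad k n (val u - 1) := rfl

instance : DirectedSystem (fun k => UPlus B k) (fun _ _ h => stab (B := B) h) where
  map_self k u := by
    refine val_injective ?_
    rw [val_stab, pad_self, add_sub_cancel]
  map_map k l n hkl _ u := by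
    refine val_injective ?_
    rw [val_stab, val_stab, val_stab, add_sub_cancel_left, pad_pad k hkl]

/-- `u` and `v` are connected by a continuous path in `U_k⁺(B)`. (Continuity in `M_k(B₊)` is
continuity of all entries.) -/
def Homotopic {k : ℕ} (u v : UPlus B k) : Prop :=
  ∃ γ : unitInterval → UPlus B k, (∀ i j, Continuous fun t => val (γ t) i j) ∧
    γ 0 = u ∧ γ 1 = v

theorem Homotopic.refl {k : ℕ} (u : UPlus B k) : Homotopic u u :=
  ⟨fun _ => u, fun _ _ => continuous_const, rfl, rfl⟩

theorem continuous_mul_entries {X : Type*} [TopologicalSpace X] {k : ℕ} {f g : X → UMat B k}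
    (hf : ∀ i j, Continuous fun t => f t i j) (hg : ∀ i j, Continuous fun t => g t i j)
    (i j : Fin k) : Continuous fun t => (f t * g t) i j := by
  simp only [CStarMatrix.mul_apply]
  exact continuous_finsetSum _ fun l _ => (hf i l).mul (hg l j)

theorem Homotopic.mul {k : ℕ} {u v u' v' : UPlus B k} (h : Homotopic u v)
    (h' : Homotopic u' v') : Homotopic (u * u') (v * v') := by
  obtain ⟨γ, hγ, rfl, rfl⟩ := h
  obtain ⟨γ', hγ', rfl, rfl⟩ := h'
  exact ⟨fun t => γ t * γ' t, continuous_mul_entries hγ hγ', rfl, rfl⟩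

theorem Homotopic.inv {k : ℕ} {u v : UPlus B k} (h : Homotopic u v) : Homotopic u⁻¹ v⁻¹ := by
  obtain ⟨γ, hγ, rfl, rfl⟩ := h
  exact ⟨fun t => (γ t)⁻¹, fun i j => continuous_star.comp (hγ j i), rfl, rfl⟩

theorem Homotopic.stab {k n : ℕ} (h : k ≤ n) {u v : UPlus B k} (huv : Homotopic u v) :
    Homotopic (stab h u) (stab h v) := by
  obtain ⟨γ, hγ, rfl, rfl⟩ := huv
  refine ⟨fun t => UPlus.stab h (γ t), fun i j => ?_, rfl, rfl⟩
  simp only [val_stab, CStarMatrix.add_apply, pad_apply]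
  refine continuous_const.add ?_
  split_ifs with hij
  · exact (hγ _ _).sub continuous_const
  · exact continuous_const

end UPlus

variable (B)

/-- The group `⋃_k U_k⁺(B)`, the union (direct limit) over the embeddings `u ↦ diag(u, 1)`. -/
def UInf : Type _ :=
  DirectLimit (fun k => UPlus B k) (fun _ _ h => UPlus.stab (B := B) h)

instance : Group (UInf B) :=
  inferInstanceAs
    (Group (DirectLimit (fun k => UPlus B k) (fun _ _ h => UPlus.stab (B := B) h)))

variable {B} in
/-- The element of `⋃_k U_k⁺(B)` given by `u ∈ U_k⁺(B)`. -/
def UInf.mk (k : ℕ) (u : UPlus B k) : UInf B := ⟦⟨k, u⟩⟧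

variable {B} in
theorem UInf.mk_mul (k : ℕ) (u v : UPlus B k) :
    UInf.mk k (u * v) = UInf.mk k u * UInf.mk k v :=
  (DirectLimit.mul_def (f := fun _ _ h => UPlus.stab (B := B) h) k u v).symm

variable {B} in
theorem UInf.mk_one (k : ℕ) : UInf.mk k (1 : UPlus B k) = 1 :=
  (DirectLimit.one_def (f := fun _ _ h => UPlus.stab (B := B) h) k).symm

variable {B} in
theorem UInf.mk_inv (k : ℕ) (u : UPlus B k) : UInf.mk k u⁻¹ = (UInf.mk k u)⁻¹ := rfl

variable {B} in
theorem UInf.mk_stab {k n : ℕ} (h : k ≤ n) (u : UPlus B k) :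
    UInf.mk n (UPlus.stab h u) = UInf.mk k u :=
  (DirectLimit.eq_of_le (f := fun _ _ h => UPlus.stab (B := B) h) (⟨k, u⟩ : Σ k, UPlus B k) n h).symm

variable {B} in
theorem UInf.exists_eq_mk (x : UInf B) : ∃ k u, x = UInf.mk k u :=
  DirectLimit.exists_eq_mk (fun _ _ h => UPlus.stab (B := B) h) x

/-- The normal subgroup of `⋃_k U_k⁺(B)` of those unitaries which are connected to `1` by a
continuous path in some `U_k⁺(B)`. -/
def UInfZero : Subgroup (UInf B) where
  carrier := {x | ∃ (k : ℕ) (u : UPlus B k), UPlus.Homotopic u 1 ∧ x = UInf.mk k u}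
  one_mem' := ⟨0, 1, UPlus.Homotopic.refl 1, (UInf.mk_one 0).symm⟩
  mul_mem' := by
    rintro _ _ ⟨k, u, hu, rfl⟩ ⟨l, v, hv, rfl⟩
    refine ⟨max k l, UPlus.stab (le_max_left k l) u * UPlus.stab (le_max_right k l) v, ?_, ?_⟩
    · have h1 := hu.stab (le_max_left k l)
      have h2 := hv.stab (le_max_right k l)
      rw [map_one] at h1 h2
      simpa using h1.mul h2
    · rw [UInf.mk_mul, UInf.mk_stab, UInf.mk_stab]
  inv_mem' := by
    rintro _ ⟨k, u, hu, rfl⟩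
    exact ⟨k, u⁻¹, by simpa using hu.inv, rfl⟩

instance : (UInfZero B).Normal where
  conj_mem := by
    rintro _ ⟨k, u, hu, rfl⟩ g
    obtain ⟨l, v, rfl⟩ := UInf.exists_eq_mk g
    refine ⟨max k l, UPlus.stab (le_max_right k l) v * UPlus.stab (le_max_left k l) u *
      (UPlus.stab (le_max_right k l) v)⁻¹, ?_, ?_⟩
    · have h1 := hu.stab (le_max_left k l)
      rw [map_one] at h1
      have h2 := (UPlus.Homotopic.refl (UPlus.stab (le_max_right k l) v)).mul h1 |>.mul
        (UPlus.Homotopic.refl (UPlus.stab (le_max_right k l) v)⁻¹)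
      simpa using h2
    · rw [UInf.mk_mul, UInf.mk_mul, UInf.mk_inv, UInf.mk_stab, UInf.mk_stab]

/-- `K₁(B)`: the group of connected components of `⋃_k U_k⁺(B)`, written additively; the addition
is induced by multiplication of unitaries. -/
abbrev KOne : Type _ := Additive (UInf B ⧸ UInfZero B)

variable {B}

/-- The class `[u] ∈ K₁(B)` of a unitary `u ∈ ⋃_k U_k⁺(B)`, given as an element of some
`U_k⁺(B)`. -/
def KOne.cls (u : Σ k, UPlus B k) : KOne B :=
  Additive.ofMul (QuotientGroup.mk (UInf.mk u.1 u.2))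

/-- The element `u - 1 ∈ M_k(B)` for `u ∈ U_k⁺(B)`. -/
def UPlus.subOne {k : ℕ} (u : UPlus B k) : Mat k B :=
  CStarMatrix.ofMatrix fun i j => ((UPlus.val u - 1) i j).snd

theorem UPlus.star_subOne_mul {k : ℕ} (u : UPlus B k) :
    star (UPlus.subOne u) * UPlus.subOne u = -(UPlus.subOne u + star (UPlus.subOne u)) := by
  suffices h : ∀ y : CStarMatrix (Fin k) (Fin k) B,
      (∀ i j, Unitization.inr (y i j) = (UPlus.val u - 1) i j) →
        star y * y = -(y + star y) from
    h (UPlus.subOne u) fun i j => Unitization.ext (u.2 i j).symm rfl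
  intro y hy
  refine CStarMatrix.ext fun i j => ?_
  refine Unitization.inr_injective (R := ℂ) ?_
  have h1 : star (UPlus.val u - 1) * (UPlus.val u - 1) =
      -((UPlus.val u - 1) + star (UPlus.val u - 1)) := by
    have h2 : star (UPlus.val u - 1) * (UPlus.val u - 1) =
        star (UPlus.val u) * UPlus.val u - 1 -
          ((UPlus.val u - 1) + star (UPlus.val u - 1)) := by
      rw [star_sub, star_one]; noncomm_ring
    rw [h2, UPlus.star_val_mul]; abel
  have h3 := congrFun (congrFun h1 i) j
  have hsum : ∀ s : Fin k → B, (Unitization.inr (∑ l, s l) : Unitization ℂ B) =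
      ∑ l, Unitization.inr (s l) :=
    fun s => map_sum (Unitization.inrNonUnitalStarAlgHom ℂ B) s Finset.univ
  change _ = -((UPlus.val u - 1) i j + star ((UPlus.val u - 1) j i)) at h3
  rw [CStarMatrix.mul_apply] at h3 ⊢
  change _ = Unitization.inr (-(y i j + star (y j i)))
  rw [hsum]
  simp only [CStarMatrix.star_apply] at h3 ⊢
  simp only [Unitization.inr_mul, Unitization.inr_neg, Unitization.inr_add, Unitization.inr_star,
    hy]
  exact h3

theorem UPlus.norm_subOne_le {k : ℕ} (u : UPlus B k) : ‖(UPlus.subOne u)‖ ≤ 2 := by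
  have h1 : ‖(UPlus.subOne u)‖ * ‖(UPlus.subOne u)‖ ≤ ‖(UPlus.subOne u)‖ + ‖(UPlus.subOne u)‖ := by
    rw [← CStarRing.norm_star_mul_self, UPlus.star_subOne_mul, norm_neg]
    exact (norm_add_le _ _).trans (by rw [norm_star])
  nlinarith [norm_nonneg (UPlus.subOne u)]

/-- The subgroup `⨁ₙ K₁(B) ⊂ ∏ₙ K₁(B)` of all sequences which vanish eventually. -/
def eventuallyZero (B : Type*) [NonUnitalCStarAlgebra B] : AddSubgroup (ℕ → KOne B) where
  carrier := {x | ∃ N, ∀ n, N ≤ n → x n = 0}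
  zero_mem' := ⟨0, fun _ _ => rfl⟩
  add_mem' := by
    rintro x y ⟨N, hN⟩ ⟨M, hM⟩
    refine ⟨max N M, fun n hn => ?_⟩
    rw [Pi.add_apply, hN n ((le_max_left _ _).trans hn), hM n ((le_max_right _ _).trans hn),
      add_zero]
  neg_mem' := by
    rintro x ⟨N, hN⟩
    exact ⟨N, fun n hn => by rw [Pi.neg_apply, hN n hn, neg_zero]⟩

end KTheory

/-! ### Discrete asymptotic homomorphisms and their homotopy classes -/

section Asymptotic

open unitInterval

/-- The discrete asymptotic algebra `𝒜_δ B = C_b(ℕ; B) / C₀(ℕ; B)`. -/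
abbrev ADelta (B : Type*) [NonUnitalCStarAlgebra B] : Type _ := SeqAlg (fun _ : ℕ => B)

variable {A B C D : Type*} [NonUnitalCStarAlgebra A] [NonUnitalCStarAlgebra B]
  [NonUnitalCStarAlgebra C] [NonUnitalCStarAlgebra D]

/-- Functoriality of `𝒜_δ`: the *-homomorphism `[n ↦ xₙ] ↦ [n ↦ f(xₙ)]`. -/
def ADelta.map (f : B →⋆ₙₐ[ℂ] C) : ADelta B →⋆ₙₐ[ℂ] ADelta C := SeqAlg.map fun _ => f

theorem ADelta.map_map (f : C →⋆ₙₐ[ℂ] D) (g : B →⋆ₙₐ[ℂ] C) (x : ADelta B) :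
    ADelta.map f (ADelta.map g x) = ADelta.map (f.comp g) x := by
  obtain ⟨x, rfl⟩ := SeqAlg.cls_surjective x
  rfl

theorem ADelta.map_id (x : ADelta B) :
    ADelta.map (NonUnitalStarAlgHom.id ℂ B) x = x := by
  obtain ⟨x, rfl⟩ := SeqAlg.cls_surjective x
  rfl

/-- The evaluation `ev_τ : IB → B`, where `IB = C([0,1], B)`. -/
def ev (τ : I) : C(I, B) →⋆ₙₐ[ℂ] B where
  toFun f := f τ
  map_smul' _ _ := rfl
  map_zero' := rfl
  map_add' _ _ := rfl
  map_mul' _ _ := rfl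
  map_star' _ := rfl

/-- Two discrete asymptotic homomorphisms `f, g : A → 𝒜_δ B` are asymptotically homotopic if there
is a *-homomorphism `H : A → 𝒜_δ(IB)` with `𝒜_δ(ev₀) ∘ H = f` and `𝒜_δ(ev₁) ∘ H = g`. -/
def AsympHomotopic (f g : A →⋆ₙₐ[ℂ] ADelta B) : Prop :=
  ∃ H : A →⋆ₙₐ[ℂ] ADelta C(I, B),
    (ADelta.map (ev 0)).comp H = f ∧ (ADelta.map (ev 1)).comp H = g

/-- Reparametrisation of `IB`. -/
def precomp (p : C(I, I)) : C(I, B) →⋆ₙₐ[ℂ] C(I, B) where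
  toFun f := f.comp p
  map_smul' _ _ := rfl
  map_zero' := rfl
  map_add' _ _ := rfl
  map_mul' _ _ := rfl
  map_star' _ := rfl

/-- The inclusion `B → IB` as constant functions. -/
def constHom : B →⋆ₙₐ[ℂ] C(I, B) where
  toFun b := ContinuousMap.const I b
  map_smul' _ _ := rfl
  map_zero' := rfl
  map_add' _ _ := rfl
  map_mul' _ _ := rfl
  map_star' _ := rfl

/-- The *-homomorphism `IB → IC` given by pointwise application of `f : B → C`. -/
def postcomp (f : B →⋆ₙₐ[ℂ] C) : C(I, B) →⋆ₙₐ[ℂ] C(I, C) where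
  toFun g := ⟨fun t => f (g t), (AddMonoidHomClass.continuous_of_bound f 1 fun a => by
      simpa using NonUnitalStarAlgHom.norm_apply_le f a).comp g.continuous⟩
  map_smul' c g := ContinuousMap.ext fun t => map_smul f c (g t)
  map_zero' := ContinuousMap.ext fun _ => map_zero f
  map_add' g h := ContinuousMap.ext fun t => map_add f (g t) (h t)
  map_mul' g h := ContinuousMap.ext fun t => map_mul f (g t) (h t)
  map_star' g := ContinuousMap.ext fun t => map_star f (g t)

/-- `t ↦ min(2t, 1)`. -/
def firstHalf : C(I, I) where
  toFun t := Set.projIcc 0 1 zero_le_one (2 * (t : ℝ))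
  continuous_toFun := by fun_prop

/-- `t ↦ max(2t - 1, 0)`. -/
def secondHalf : C(I, I) where
  toFun t := Set.projIcc 0 1 zero_le_one (2 * (t : ℝ) - 1)
  continuous_toFun := by fun_prop

theorem firstHalf_zero : firstHalf 0 = 0 :=
  Set.projIcc_of_le_left zero_le_one (by simp)

theorem firstHalf_one : firstHalf 1 = 1 :=
  Set.projIcc_of_right_le zero_le_one (by norm_num)

theorem secondHalf_zero : secondHalf 0 = 0 :=
  Set.projIcc_of_le_left zero_le_one (by simp)

theorem secondHalf_one : secondHalf 1 = 1 :=
  Set.projIcc_of_right_le zero_le_one (by norm_num)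

theorem firstHalf_eq_one_or (t : I) : firstHalf t = 1 ∨ secondHalf t = 0 := by
  rcases le_total (1 / 2 : ℝ) (t : ℝ) with h | h
  · exact Or.inl (Set.projIcc_of_right_le zero_le_one (by linarith))
  · exact Or.inr (Set.projIcc_of_le_left zero_le_one (by linarith))

/-- `t ↦ t / 2`. -/
def lowerHalf : C(I, I) where
  toFun t := ⟨(t : ℝ) / 2, by have := t.2.1; have := t.2.2; constructor <;> linarith⟩
  continuous_toFun := by fun_prop

/-- `t ↦ (t + 1) / 2`. -/
def upperHalf : C(I, I) where
  toFun t := ⟨((t : ℝ) + 1) / 2, by have := t.2.1; have := t.2.2; constructor <;> linarith⟩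
  continuous_toFun := by fun_prop

theorem firstHalf_lowerHalf (t : I) : firstHalf (lowerHalf t) = t := by
  have : (2 * ((t : ℝ) / 2)) = t := by ring
  change Set.projIcc 0 1 zero_le_one (2 * ((t : ℝ) / 2)) = t
  rw [this, Set.projIcc_val]

theorem secondHalf_lowerHalf (t : I) : secondHalf (lowerHalf t) = 0 := by
  refine Set.projIcc_of_le_left zero_le_one ?_
  have := t.2.2
  change 2 * ((t : ℝ) / 2) - 1 ≤ 0
  linarith

theorem firstHalf_upperHalf (t : I) : firstHalf (upperHalf t) = 1 := by
  refine Set.projIcc_of_right_le zero_le_one ?_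
  have := t.2.1
  change 1 ≤ 2 * (((t : ℝ) + 1) / 2)
  linarith

theorem secondHalf_upperHalf (t : I) : secondHalf (upperHalf t) = t := by
  have : (2 * (((t : ℝ) + 1) / 2) - 1) = t := by ring
  change Set.projIcc 0 1 zero_le_one (2 * (((t : ℝ) + 1) / 2) - 1) = t
  rw [this, Set.projIcc_val]

theorem eq_of_halves {x y : ADelta C(I, B)}
    (h1 : ADelta.map (precomp lowerHalf) x = ADelta.map (precomp lowerHalf) y)
    (h2 : ADelta.map (precomp upperHalf) x = ADelta.map (precomp upperHalf) y) : x = y := by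
  obtain ⟨x, rfl⟩ := SeqAlg.cls_surjective x
  obtain ⟨y, rfl⟩ := SeqAlg.cls_surjective y
  have e1 := mem_nullSeq.1 (SeqAlg.cls_eq_iff.1 h1)
  have e2 := mem_nullSeq.1 (SeqAlg.cls_eq_iff.1 h2)
  refine SeqAlg.cls_eq_iff.2 (mem_nullSeq.2 ?_)
  refine squeeze_zero (fun n => norm_nonneg _) (fun n => ?_) (by simpa using e1.add e2)
  rw [ContinuousMap.norm_le _ (by positivity)]
  intro t
  rcases le_total (t : ℝ) (1 / 2 : ℝ) with h | h
  · have ht : lowerHalf ⟨2 * (t : ℝ), by have := t.2.1; constructor <;> linarith⟩ = t :=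
      Subtype.ext (by change 2 * (t : ℝ) / 2 = t; ring)
    have := ContinuousMap.norm_coe_le_norm ((SeqAlg.mapSeq (fun _ => precomp lowerHalf) x -
      SeqAlg.mapSeq (fun _ => precomp lowerHalf) y) n)
      ⟨2 * (t : ℝ), by have := t.2.1; constructor <;> linarith⟩
    change ‖x n (lowerHalf _) - y n (lowerHalf _)‖ ≤ _ at this
    rw [ht] at this
    exact this.trans (le_add_of_nonneg_right (norm_nonneg _))
  · have ht : upperHalf ⟨2 * (t : ℝ) - 1, by have := t.2.2; constructor <;> linarith⟩ = t :=
      Subtype.ext (by change (2 * (t : ℝ) - 1 + 1) / 2 = t; ring)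
    have := ContinuousMap.norm_coe_le_norm ((SeqAlg.mapSeq (fun _ => precomp upperHalf) x -
      SeqAlg.mapSeq (fun _ => precomp upperHalf) y) n)
      ⟨2 * (t : ℝ) - 1, by have := t.2.2; constructor <;> linarith⟩
    change ‖x n (upperHalf _) - y n (upperHalf _)‖ ≤ _ at this
    rw [ht] at this
    exact this.trans (le_add_of_nonneg_left (norm_nonneg _))

/-- Concatenation of elements of `𝒜_δ(IB)` with matching end points. -/
def glue (x y : ADelta C(I, B)) : ADelta C(I, B) :=
  ADelta.map (precomp firstHalf) x + ADelta.map (precomp secondHalf) y -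
    ADelta.map constHom (ADelta.map (ev 0) y)

theorem glue_lower (x y : ADelta C(I, B)) :
    ADelta.map (precomp lowerHalf) (glue x y) = x := by
  have e1 : (precomp lowerHalf).comp (precomp (B := B) firstHalf) =
      NonUnitalStarAlgHom.id ℂ C(I, B) :=
    NonUnitalStarAlgHom.ext fun f => ContinuousMap.ext fun t =>
      congrArg f (firstHalf_lowerHalf t)
  have e2 : (precomp lowerHalf).comp (precomp (B := B) secondHalf) =
      constHom.comp (ev 0) :=
    NonUnitalStarAlgHom.ext fun f => ContinuousMap.ext fun t =>
      congrArg f (secondHalf_lowerHalf t)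
  have e3 : (precomp lowerHalf).comp (constHom (B := B)) = constHom := rfl
  simp only [glue, map_add, map_sub, ADelta.map_map, e1, e2, ADelta.map_id]
  rw [← NonUnitalStarAlgHom.comp_assoc, e3, add_sub_cancel_right]

theorem glue_upper (x y : ADelta C(I, B)) (h : ADelta.map (ev 1) x = ADelta.map (ev 0) y) :
    ADelta.map (precomp upperHalf) (glue x y) = y := by
  have e1 : (precomp upperHalf).comp (precomp (B := B) firstHalf) =
      constHom.comp (ev 1) :=
    NonUnitalStarAlgHom.ext fun f => ContinuousMap.ext fun t =>
      congrArg f (firstHalf_upperHalf t)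
  have e2 : (precomp upperHalf).comp (precomp (B := B) secondHalf) =
      NonUnitalStarAlgHom.id ℂ C(I, B) :=
    NonUnitalStarAlgHom.ext fun f => ContinuousMap.ext fun t =>
      congrArg f (secondHalf_upperHalf t)
  have e3 : (precomp upperHalf).comp (constHom (B := B)) = constHom := rfl
  rw [glue, ← h, map_sub, map_add, ADelta.map_map, ADelta.map_map, ADelta.map_map, e1, e2, e3,
    ADelta.map_id, ADelta.map_map, add_sub_cancel_left]

theorem AsympHomotopic.refl (f : A →⋆ₙₐ[ℂ] ADelta B) : AsympHomotopic f f := by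
  refine ⟨(ADelta.map constHom).comp f, ?_, ?_⟩ <;>
  · refine NonUnitalStarAlgHom.ext fun a => ?_
    change ADelta.map _ (ADelta.map _ (f a)) = f a
    rw [ADelta.map_map]
    exact ADelta.map_id (f a)

theorem AsympHomotopic.symm {f g : A →⋆ₙₐ[ℂ] ADelta B} (h : AsympHomotopic f g) :
    AsympHomotopic g f := by
  obtain ⟨H, rfl, rfl⟩ := h
  have e0 : (ev 0).comp (precomp (B := B) ⟨σ, continuous_symm⟩) = ev 1 :=
    NonUnitalStarAlgHom.ext fun f => congrArg f symm_zero
  have e1 : (ev 1).comp (precomp (B := B) ⟨σ, continuous_symm⟩) = ev 0 :=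
    NonUnitalStarAlgHom.ext fun f => congrArg f symm_one
  refine ⟨(ADelta.map (precomp ⟨σ, continuous_symm⟩)).comp H,
    NonUnitalStarAlgHom.ext fun a => ?_, NonUnitalStarAlgHom.ext fun a => ?_⟩
  · change ADelta.map _ (ADelta.map _ (H a)) = ADelta.map _ (H a)
    rw [ADelta.map_map, e0]
  · change ADelta.map _ (ADelta.map _ (H a)) = ADelta.map _ (H a)
    rw [ADelta.map_map, e1]

theorem AsympHomotopic.trans {f g h : A →⋆ₙₐ[ℂ] ADelta B} (hfg : AsympHomotopic f g)
    (hgh : AsympHomotopic g h) : AsympHomotopic f h := by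
  obtain ⟨H, rfl, hH⟩ := hfg
  obtain ⟨K, hK, rfl⟩ := hgh
  have hHK : ∀ a, ADelta.map (ev 1) (H a) = ADelta.map (ev 0) (K a) := fun a =>
    (DFunLike.congr_fun hH a).trans (DFunLike.congr_fun hK a).symm
  have hl : ∀ a, ADelta.map (precomp lowerHalf) (glue (H a) (K a)) = H a :=
    fun a => glue_lower _ _
  have hu : ∀ a, ADelta.map (precomp upperHalf) (glue (H a) (K a)) = K a :=
    fun a => glue_upper _ _ (hHK a)
  let G : A →⋆ₙₐ[ℂ] ADelta C(I, B) :=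
    { toFun := fun a => glue (H a) (K a)
      map_smul' := fun c a => eq_of_halves
        (by rw [hl, map_smul, map_smul, hl]; rfl) (by rw [hu, map_smul, map_smul, hu]; rfl)
      map_zero' := eq_of_halves
        (by rw [hl, map_zero, map_zero]) (by rw [hu, map_zero, map_zero])
      map_add' := fun a b => eq_of_halves
        (by rw [hl, map_add, map_add, hl, hl]) (by rw [hu, map_add, map_add, hu, hu])
      map_mul' := fun a b => eq_of_halves
        (by rw [hl, map_mul, map_mul, hl, hl]) (by rw [hu, map_mul, map_mul, hu, hu])
      map_star' := fun a => eq_of_halves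
        (by rw [hl, map_star, map_star, hl]) (by rw [hu, map_star, map_star, hu]) }
  have e0 : (ev 0).comp (precomp (B := B) lowerHalf) = ev 0 :=
    NonUnitalStarAlgHom.ext fun f =>
      congrArg f (Subtype.ext (by change (0 : ℝ) / 2 = 0; norm_num))
  have e1 : (ev 1).comp (precomp (B := B) upperHalf) = ev 1 :=
    NonUnitalStarAlgHom.ext fun f =>
      congrArg f (Subtype.ext (by change ((1 : ℝ) + 1) / 2 = 1; norm_num))
  refine ⟨G, NonUnitalStarAlgHom.ext fun a => ?_, NonUnitalStarAlgHom.ext fun a => ?_⟩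
  · change ADelta.map (ev 0) (glue (H a) (K a)) = ADelta.map (ev 0) (H a)
    rw [← e0, ← ADelta.map_map, hl, e0]
  · change ADelta.map (ev 1) (glue (H a) (K a)) = ADelta.map (ev 1) (K a)
    rw [← e1, ← ADelta.map_map, hu, e1]

variable (A B) in
/-- Asymptotic homotopy is an equivalence relation. -/
def asympSetoid : Setoid (A →⋆ₙₐ[ℂ] ADelta B) where
  r := AsympHomotopic
  iseqv := ⟨AsympHomotopic.refl, AsympHomotopic.symm, AsympHomotopic.trans⟩

variable (A B) in
/-- The set `[[A, B]]_δ` of asymptotic homotopy classes of discrete asymptotic homomorphisms from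
`A` to `B`. -/
def AsympClasses : Type _ := Quotient (asympSetoid A B)

/-- The class of a discrete asymptotic homomorphism. -/
def AsympClasses.mk (f : A →⋆ₙₐ[ℂ] ADelta B) : AsympClasses A B := Quotient.mk (asympSetoid A B) f

/-- The *-homomorphism `a ↦ φ(f(a)) + ψ(g(a))`, for *-homomorphisms `f, g : A → B` and
*-homomorphisms `φ, ψ : B → C` with orthogonal ranges. -/
def orthSum (φ ψ : B →⋆ₙₐ[ℂ] C) (h : ∀ x y, φ x * ψ y = 0) (h' : ∀ x y, ψ x * φ y = 0)
    (f g : A →⋆ₙₐ[ℂ] B) : A →⋆ₙₐ[ℂ] C where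
  toFun a := φ (f a) + ψ (g a)
  map_smul' c a := by simp [map_smul, smul_add]
  map_zero' := by simp
  map_add' a b := by simp only [map_add]; abel
  map_mul' a b := by simp only [map_mul, add_mul, mul_add, h, h', add_zero, zero_add]
  map_star' a := by simp only [map_star, star_add]

theorem SeqAlg.map_mul_map_eq_zero {X Y : ℕ → Type*} [∀ n, NonUnitalCStarAlgebra (X n)]
    [∀ n, NonUnitalCStarAlgebra (Y n)] {φ ψ : ∀ n, X n →⋆ₙₐ[ℂ] Y n}
    (h : ∀ n x y, φ n x * ψ n y = 0) (x y : SeqAlg X) :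
    SeqAlg.map φ x * SeqAlg.map ψ y = 0 := by
  obtain ⟨x, rfl⟩ := SeqAlg.cls_surjective x
  obtain ⟨y, rfl⟩ := SeqAlg.cls_surjective y
  rw [SeqAlg.map_cls, SeqAlg.map_cls, ← SeqAlg.cls_mul, ← map_zero (SeqAlg.cls (A := Y))]
  exact congrArg SeqAlg.cls (lp.ext (funext fun n => h n (x n) (y n)))

theorem Stab.map_mul_map_eq_zero {φ ψ : B →⋆ₙₐ[ℂ] C} (h : ∀ x y, φ x * ψ y = 0)
    (x y : Stab B) : Stab.map φ x * Stab.map ψ y = 0 := by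
  refine Subtype.ext (SeqAlg.map_mul_map_eq_zero (fun n v w => ?_) x.1 y.1)
  exact CStarMatrix.ext fun i j =>
    (CStarMatrix.mul_apply ..).trans (Finset.sum_eq_zero fun l _ => h _ _)

/-! ### Suspensions and the group structure on `[[A, ΣB ⊗ 𝒦]]_δ` -/

variable (B) in
/-- The functions `f ∈ IB = C([0,1], B)` with `f(0) = f(1) = 0`. -/
def suspSubalgebra : NonUnitalStarSubalgebra ℂ C(I, B) where
  carrier := {f | f 0 = 0 ∧ f 1 = 0}
  zero_mem' := ⟨rfl, rfl⟩
  add_mem' := by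
    rintro f g ⟨hf0, hf1⟩ ⟨hg0, hg1⟩
    exact ⟨by simp [hf0, hg0], by simp [hf1, hg1]⟩
  mul_mem' := by
    rintro f g ⟨hf0, hf1⟩ ⟨hg0, hg1⟩
    exact ⟨by simp [hf0], by simp [hf1]⟩
  smul_mem' := by
    rintro c f ⟨hf0, hf1⟩
    exact ⟨by simp [hf0], by simp [hf1]⟩
  star_mem' := by
    rintro f ⟨hf0, hf1⟩
    exact ⟨by simp [hf0], by simp [hf1]⟩

theorem isClosed_suspSubalgebra : IsClosed (suspSubalgebra B : Set C(I, B)) :=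
  (isClosed_eq (continuous_eval_const 0) continuous_const).inter
    (isClosed_eq (continuous_eval_const 1) continuous_const)

variable (B) in
/-- The suspension `ΣB = {f ∈ C([0,1], B) : f(0) = f(1) = 0}`. -/
def Susp : Type _ := suspSubalgebra B

instance : NonUnitalCStarAlgebra (Susp B) :=
  haveI : IsClosed (suspSubalgebra B : Set C(I, B)) := isClosed_suspSubalgebra
  inferInstanceAs (NonUnitalCStarAlgebra (suspSubalgebra B))

/-- Reparametrisation of `ΣB` along a self-map of `[0,1]` fixing the end points. -/
def Susp.reparam (p : C(I, I)) (h0 : p 0 = 0) (h1 : p 1 = 1) : Susp B →⋆ₙₐ[ℂ] Susp B :=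
  NonUnitalStarAlgHom.codRestrict
    ((precomp p).comp (NonUnitalStarSubalgebraClass.subtype (suspSubalgebra B)))
    (suspSubalgebra B) fun f =>
      ⟨(congrArg f.1 h0).trans f.2.1, (congrArg f.1 h1).trans f.2.2⟩

/-- `ΣB → ΣB`, `f ↦ (t ↦ f(2t) for t ≤ 1/2, and 0 for t ≥ 1/2)`. -/
def Susp.left : Susp B →⋆ₙₐ[ℂ] Susp B := Susp.reparam firstHalf firstHalf_zero firstHalf_one

/-- `ΣB → ΣB`, `f ↦ (t ↦ 0 for t ≤ 1/2, and f(2t - 1) for t ≥ 1/2)`. -/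
def Susp.right : Susp B →⋆ₙₐ[ℂ] Susp B := Susp.reparam secondHalf secondHalf_zero secondHalf_one

theorem Susp.left_mul_right (f g : Susp B) : Susp.left f * Susp.right g = 0 := by
  refine Subtype.ext (ContinuousMap.ext fun t => ?_)
  change f.1 (firstHalf t) * g.1 (secondHalf t) = 0
  rcases firstHalf_eq_one_or t with h | h
  · rw [h, f.2.2, zero_mul]
  · rw [h, g.2.1, mul_zero]

theorem Susp.right_mul_left (f g : Susp B) : Susp.right f * Susp.left g = 0 := by
  refine Subtype.ext (ContinuousMap.ext fun t => ?_)
  change f.1 (secondHalf t) * g.1 (firstHalf t) = 0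
  rcases firstHalf_eq_one_or t with h | h
  · rw [h, g.2.2, mul_zero]
  · rw [h, f.2.1, zero_mul]

/-- The concatenation of two discrete asymptotic homomorphisms `f, g : A → 𝒜_δ(ΣB ⊗ 𝒦)`: the
composition of `(f, g)` with the map `𝒜_δ(ΣB ⊗ 𝒦) ⊕ 𝒜_δ(ΣB ⊗ 𝒦) → 𝒜_δ(ΣB ⊗ 𝒦)` induced by the
concatenation `ΣB ⊕ ΣB → ΣB`. -/
def concat (f g : A →⋆ₙₐ[ℂ] ADelta (Stab (Susp B))) : A →⋆ₙₐ[ℂ] ADelta (Stab (Susp B)) :=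
  orthSum (ADelta.map (Stab.map Susp.left)) (ADelta.map (Stab.map Susp.right))
    (SeqAlg.map_mul_map_eq_zero fun _ => Stab.map_mul_map_eq_zero Susp.left_mul_right)
    (SeqAlg.map_mul_map_eq_zero fun _ => Stab.map_mul_map_eq_zero Susp.right_mul_left) f g

theorem AsympHomotopic.concat {f g f' g' : A →⋆ₙₐ[ℂ] ADelta (Stab (Susp B))}
    (h : AsympHomotopic f g) (h' : AsympHomotopic f' g') :
    AsympHomotopic (concat f f') (concat g g') := by
  obtain ⟨H, rfl, rfl⟩ := h
  obtain ⟨H', rfl, rfl⟩ := h'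
  have key : ∀ (τ : I) (φ : Stab (Susp B) →⋆ₙₐ[ℂ] Stab (Susp B)) (x : ADelta C(I, Stab (Susp B))),
      ADelta.map (ev τ) (ADelta.map (postcomp φ) x) = ADelta.map φ (ADelta.map (ev τ) x) := by
    intro τ φ x
    rw [ADelta.map_map, ADelta.map_map]
    rfl
  refine ⟨orthSum (ADelta.map (postcomp (Stab.map Susp.left)))
    (ADelta.map (postcomp (Stab.map Susp.right)))
    (SeqAlg.map_mul_map_eq_zero fun _ u v => ContinuousMap.ext fun t =>
      Stab.map_mul_map_eq_zero Susp.left_mul_right (u t) (v t))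
    (SeqAlg.map_mul_map_eq_zero fun _ u v => ContinuousMap.ext fun t =>
      Stab.map_mul_map_eq_zero Susp.right_mul_left (u t) (v t)) H H',
    NonUnitalStarAlgHom.ext fun a => ?_, NonUnitalStarAlgHom.ext fun a => ?_⟩
  · change ADelta.map (ev 0) (ADelta.map _ (H a) + ADelta.map _ (H' a)) =
      ADelta.map _ (ADelta.map (ev 0) (H a)) + ADelta.map _ (ADelta.map (ev 0) (H' a))
    rw [map_add, key, key]
  · change ADelta.map (ev 1) (ADelta.map _ (H a) + ADelta.map _ (H' a)) =
      ADelta.map _ (ADelta.map (ev 1) (H a)) + ADelta.map _ (ADelta.map (ev 1) (H' a))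
    rw [map_add, key, key]

/-- The addition on `[[A, ΣB ⊗ 𝒦]]_δ`, given by concatenation. -/
def AsympClasses.concat :
    AsympClasses A (Stab (Susp B)) → AsympClasses A (Stab (Susp B)) →
      AsympClasses A (Stab (Susp B)) :=
  Quotient.map₂ DTheory.concat fun _ _ h _ _ h' => AsympHomotopic.concat h h'

theorem AsympClasses.concat_mk (f g : A →⋆ₙₐ[ℂ] ADelta (Stab (Susp B))) :
    AsympClasses.concat (AsympClasses.mk f) (AsympClasses.mk g) =
      AsympClasses.mk (DTheory.concat f g) := rfl

end Asymptotic

/-! ### The C*-algebra `Σ` and the sequences `n ↦ uₙ - 1` -/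

section CircleAlgebra

/-- The functions `φ ∈ C(S¹)` with `φ(1) = 0`. -/
def circleSubalgebra : NonUnitalStarSubalgebra ℂ C(Circle, ℂ) where
  carrier := {φ | φ 1 = 0}
  zero_mem' := rfl
  add_mem' := by
    intro f g (hf : f 1 = 0) (hg : g 1 = 0)
    change f 1 + g 1 = 0
    rw [hf, hg, add_zero]
  mul_mem' := by
    intro f g (hf : f 1 = 0) _
    change f 1 * g 1 = 0
    rw [hf, zero_mul]
  smul_mem' := by
    intro c f (hf : f 1 = 0)
    change c * f 1 = 0
    rw [hf, mul_zero]
  star_mem' := by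
    intro f (hf : f 1 = 0)
    change star (f 1) = 0
    rw [hf, star_zero]

theorem isClosed_circleSubalgebra : IsClosed (circleSubalgebra : Set C(Circle, ℂ)) :=
  isClosed_eq (continuous_eval_const 1) continuous_const

/-- The C*-algebra `Σ = C₀(0,1) ≅ C₀(ℝ)`, identified with `{φ ∈ C(S¹) : φ(1) = 0}`. -/
def CircleSusp : Type := circleSubalgebra

instance : NonUnitalCStarAlgebra CircleSusp :=
  haveI : IsClosed (circleSubalgebra : Set C(Circle, ℂ)) := isClosed_circleSubalgebra
  inferInstanceAs (NonUnitalCStarAlgebra circleSubalgebra)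

/-- The function `ω(z) = z - 1` in `Σ`. -/
def omega : CircleSusp :=
  ⟨⟨fun z => (z : ℂ) - 1, by fun_prop⟩, by
    change ((1 : Circle) : ℂ) - 1 = 0
    simp⟩

variable {B : Type*} [NonUnitalCStarAlgebra B]

/-- The bounded sequence `n ↦ uₙ - 1 ∈ M_{k(n)}(B) ⊂ B ⊗ 𝒦`, for unitaries
`uₙ ∈ U_{k(n)}⁺(B)`. -/
def subOneSeq (u : ℕ → Σ k, UPlus B k) : lp (fun _ : ℕ => Stab B) ∞ :=
  ⟨fun n => Stab.incl (u n).1 (UPlus.subOne (u n).2), memℓp_infty ⟨2, by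
    rintro _ ⟨n, rfl⟩
    exact (NonUnitalStarAlgHom.norm_apply_le (Stab.incl (B := B) (u n).1) _).trans
      (UPlus.norm_subOne_le (u n).2)⟩⟩

/-- The element `[n ↦ uₙ - 1] ∈ 𝒜_δ(B ⊗ 𝒦)`. -/
def subOneCls (u : ℕ → Σ k, UPlus B k) : ADelta (Stab B) := SeqAlg.cls (subOneSeq u)

end CircleAlgebra

end DTheory

end

open DTheory

/-! Call `x` quasi-unitary if `1 + x` is a unitary of the unitization. This is a condition on `x` by
*-polynomials without constant term, and `Σ` is the universal C*-algebra on such an element, namely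
`ω`: existence is functional calculus (`exists_starHom_omega`), uniqueness is the density of
polynomials in `ω` (`starHom_ext_omega`). Discrete asymptotic homomorphisms out of `Σ`, and
homotopies between them, are therefore just quasi-unitaries in algebras of bounded sequences modulo
null sequences.

The relation is stable: polar decomposition moves an approximate solution to a nearby exact one
(`exists_isQuasiUnitary_near`). Quasi-unitaries of the quotient thus lift to sequences of
quasi-unitaries (`exists_quSeq`), and those of `B ⊗ 𝒦` can be approximated from matrix algebras.
This gives surjectivity (`exists_eq_subOneCls`).

For the fibres, a homotopy lifts to a sequence of paths of quasi-unitaries whose end points approach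
the given ones. Unitaries at distance less than `2` are connected, so the `K₁` classes agree for
large `n` (`AsympHomotopic.eventually_cls_eq`). Conversely, a path chosen separately for each large
`n` suffices, since any sequence of quasi-unitary paths is bounded and no uniformity in `n` is asked
for (`asympHomotopic_of_cls_eq`).

The suspension matters only for the addition. Two unitaries squeezed into disjoint halves of the
interval commute, their product is the concatenation, and squeezing does not change `K₁` classes. So
concatenation matches the sum in `K₁(ΣB)`, which is abelian, and the group axioms descend along the
surjection. -/

open scoped ContinuousMapZero

noncomputable section

namespace DTheory

/-! ### Quasi-unitary elements and the stability of their defining relations. -/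

section QuasiUnitary

variable {C D : Type*} [NonUnitalCStarAlgebra C] [NonUnitalCStarAlgebra D]

/-- An element `x` such that `1 + x` is a unitary of the unitization. -/
def IsQuasiUnitary (x : C) : Prop :=
  star x * x + x + star x = 0 ∧ x * star x + x + star x = 0

theorem isQuasiUnitary_iff_mem_unitary {x : C} :
    IsQuasiUnitary x ↔ (1 + (x : Unitization ℂ C)) ∈ unitary (Unitization ℂ C) := by
  have e1 : star (1 + (x : Unitization ℂ C)) * (1 + x) =
      1 + ((star x * x + x + star x : C) : Unitization ℂ C) := by
    simp only [star_add, star_one, Unitization.inr_add, Unitization.inr_mul, Unitization.inr_star]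
    noncomm_ring
  have e2 : (1 + (x : Unitization ℂ C)) * star (1 + (x : Unitization ℂ C)) =
      1 + ((x * star x + x + star x : C) : Unitization ℂ C) := by
    simp only [star_add, star_one, Unitization.inr_add, Unitization.inr_mul, Unitization.inr_star]
    noncomm_ring
  have e3 : ∀ a : C, (1 + (a : Unitization ℂ C) = 1 ↔ a = 0) := fun a => by
    rw [add_eq_left, ← Unitization.inr_zero, Unitization.inr_injective.eq_iff]
  rw [Unitary.mem_iff, e1, e2, e3, e3]
  rfl

theorem isQuasiUnitary_zero : IsQuasiUnitary (0 : C) := by simp [IsQuasiUnitary]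

theorem IsQuasiUnitary.map {x : C} (hx : IsQuasiUnitary x) (f : C →⋆ₙₐ[ℂ] D) :
    IsQuasiUnitary (f x) := by
  constructor
  · simpa [map_star] using congrArg f hx.1
  · simpa [map_star] using congrArg f hx.2

/-- The bound is independent of the algebra, so every sequence of quasi-unitaries, in whatever
algebras, is bounded. -/
theorem IsQuasiUnitary.norm_le {x : C} (hx : IsQuasiUnitary x) : ‖x‖ ≤ 2 := by
  have h1 : ‖x‖ * ‖x‖ ≤ ‖x‖ + ‖x‖ := by
    have h2 : star x * x = -(x + star x) := by
      rw [← sub_eq_zero, sub_neg_eq_add, ← add_assoc, hx.1]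
    rw [← CStarRing.norm_star_mul_self, h2, norm_neg]
    exact (norm_add_le _ _).trans (by rw [norm_star])
  nlinarith [norm_nonneg x]

theorem IsQuasiUnitary.isStarNormal {x : C} (hx : IsQuasiUnitary x) : IsStarNormal x := by
  refine ⟨?_⟩
  have := hx.1.trans hx.2.symm
  exact add_right_cancel (add_right_cancel this)

/-- The spectrum of the unitary `1 + x` lies on the unit circle. After a shift by `1`, functions in
`Σ` can be evaluated on the quasispectrum of `x`. -/
theorem IsQuasiUnitary.norm_add_one_of_mem_quasispectrum {x : C} (hx : IsQuasiUnitary x) {z : ℂ}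
    (hz : z ∈ quasispectrum ℂ x) : ‖z + 1‖ = 1 := by
  rw [Unitization.quasispectrum_eq_spectrum_inr] at hz
  have h1 : z + 1 ∈ spectrum ℂ (1 + (x : Unitization ℂ C)) := by
    have := (spectrum.add_mem_add_iff (a := (x : Unitization ℂ C)) (r := z) (s := (1 : ℂ))).2 hz
    simpa only [map_one, add_comm (1 : Unitization ℂ C)] using this
  simpa using Unitary.spectrum_subset_circle ⟨_, isQuasiUnitary_iff_mem_unitary.1 hx⟩ h1

/-- The inverse square root `1 + c = (1 + b)^(-1/2)` of a small self-adjoint perturbation of the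
identity. -/
theorem exists_inv_sqrt {b : C} (hb : IsSelfAdjoint b) {δ : ℝ} (hδ : δ ≤ 1 / 2) (hbδ : ‖b‖ ≤ δ) :
    ∃ c : C, IsSelfAdjoint c ∧ ‖c‖ ≤ δ ∧
      (1 + (c : Unitization ℂ C)) * (1 + b) * (1 + c) = 1 := by
  let f : ℝ → ℝ := fun t => (√(1 + t))⁻¹ - 1
  have hspec : ∀ t ∈ quasispectrum ℝ b, |t| ≤ 1 / 2 := fun t ht =>
    ((NonUnitalIsometricContinuousFunctionalCalculus.norm_quasispectrum_le b ht).trans hbδ).trans hδ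
  have hpos : ∀ t ∈ quasispectrum ℝ b, 1 / 2 ≤ 1 + t := fun t ht => by
    have := abs_le.1 (hspec t ht); linarith
  have hf : ContinuousOn f (quasispectrum ℝ b) := by
    refine ContinuousOn.sub (ContinuousOn.inv₀ (by fun_prop) fun t ht => ?_) continuousOn_const
    have := hpos t ht
    positivity
  let F : C(quasispectrum ℝ b, ℝ)₀ := ⟨⟨fun t => f t, hf.domRestrict⟩, by
    change f 0 = 0; simp [f]⟩
  let X : C(quasispectrum ℝ b, ℝ)₀ := .id _
  have hX : cfcₙHom hb X = b := cfcₙHom_id hb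
  -- This is `(1 + F)(1 + X)(1 + F) = 1` with the `1` cancelled, so that it makes sense among
  -- functions vanishing at `0` and the non-unital calculus can transport it.
  have hF : F + F + F * F + X + F * X + X * F + F * X * F = 0 := by
    ext t
    have ht := hpos t t.2
    have hs : √(1 + t) ^ 2 = 1 + t := Real.sq_sqrt (by linarith)
    have hs0 : √(1 + (t : ℝ)) ≠ 0 := by positivity
    change f t + f t + f t * f t + t + f t * t + t * f t + f t * t * f t = 0
    have : (t : ℝ) = √(1 + (t : ℝ)) ^ 2 - 1 := by rw [hs]; ring
    simp only [f]
    generalize √(1 + (t : ℝ)) = s at *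
    rw [this]
    field_simp
    ring
  have hc := congrArg (cfcₙHom hb) hF
  simp only [map_add, map_mul, map_zero, hX] at hc
  refine ⟨cfcₙHom hb F, cfcₙHom_predicate hb F, ?_, ?_⟩
  · rw [norm_cfcₙHom b F hb, ContinuousMapZero.norm_def,
      ContinuousMap.norm_le _ ((norm_nonneg _).trans hbδ)]
    intro t
    have ht := hpos t t.2
    have hs : √(1 + t) ^ 2 = 1 + t := Real.sq_sqrt (by linarith)
    have htδ : |(t : ℝ)| ≤ δ :=
      (NonUnitalIsometricContinuousFunctionalCalculus.norm_quasispectrum_le b t.2).trans hbδ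
    refine le_trans ?_ htδ
    change |(√(1 + (t : ℝ)))⁻¹ - 1| ≤ _
    have h1 : (1 : ℝ) / 2 ≤ √(1 + t) := by
      apply Real.le_sqrt_of_sq_le; linarith
    have : (t : ℝ) = √(1 + (t : ℝ)) ^ 2 - 1 := by rw [hs]; ring
    rw [hs.symm] at ht
    generalize √(1 + (t : ℝ)) = s at *
    have h2 : s⁻¹ - 1 = -((s - 1) * s⁻¹) := by field_simp; ring
    rw [this, h2, show s ^ 2 - 1 = (s - 1) * (s + 1) by ring, abs_neg, abs_mul, abs_mul]
    gcongr
    -- What remains is `1 ≤ s(s + 1)`. It follows from `s² ≥ 1/2` and `s ≥ 1/2`, which is where `δ ≤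
    -- 1/2` is needed.
    rw [inv_le_comm₀ (by positivity)
      (by positivity), inv_le_iff_one_le_mul₀ (by positivity)]
    nlinarith
  · generalize cfcₙHom hb F = c at hc
    have h := congrArg (fun a : C => (1 + a : Unitization ℂ C)) hc
    simp only [Unitization.inr_add, Unitization.inr_mul, Unitization.inr_zero, add_zero] at h
    calc _ = 1 + ((c : Unitization ℂ C) + c + c * c + b + c * b + b * c + c * b * c) := by
          noncomm_ring
      _ = 1 := h

/-- Unitary polar decomposition: an approximately quasi-unitary element is close to a
quasi-unitary one. -/
theorem exists_isQuasiUnitary_near {x : C} {δ : ℝ} (hδ : δ ≤ 1 / 2)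
    (h1 : ‖star x * x + x + star x‖ ≤ δ) (h2 : ‖x * star x + x + star x‖ ≤ δ) :
    ∃ y : C, IsQuasiUnitary y ∧ ‖y - x‖ ≤ δ * (1 + ‖x‖) := by
  have hsa : ∀ z : C, IsSelfAdjoint (star z * z + z + star z) := fun z => by
    simp only [IsSelfAdjoint, star_add, star_mul, star_star]; abel
  obtain ⟨c, hc, hcδ, hcbc⟩ := exists_inv_sqrt (hsa x) hδ h1
  have hsb := hsa (star x)
  rw [star_star, add_assoc, add_comm (star x), ← add_assoc] at hsb
  -- With `u = 1 + x` and `e = (u*u)^(-1/2)`, the element `ue` is automatically an isometry. The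
  -- second defect makes `uu*` invertible as well, which upgrades the isometry to a unitary.
  obtain ⟨d, -, -, hd⟩ := exists_inv_sqrt hsb hδ h2
  obtain ⟨u, hu⟩ : ∃ u : Unitization ℂ C, u = 1 + x := ⟨_, rfl⟩
  obtain ⟨e, he⟩ : ∃ e : Unitization ℂ C, e = 1 + c := ⟨_, rfl⟩
  obtain ⟨g, hg⟩ : ∃ g : Unitization ℂ C, g = 1 + d := ⟨_, rfl⟩
  have e1 : 1 + ((star x * x + x + star x : C) : Unitization ℂ C) = star u * u := by
    simp only [hu, star_add, star_one, Unitization.inr_add, Unitization.inr_mul,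
      Unitization.inr_star]
    noncomm_ring
  have e2 : 1 + ((x * star x + x + star x : C) : Unitization ℂ C) = u * star u := by
    simp only [hu, star_add, star_one, Unitization.inr_add, Unitization.inr_mul,
      Unitization.inr_star]
    noncomm_ring
  rw [e1, ← he] at hcbc
  rw [e2, ← hg] at hd
  have hes : star e = e := by
    rw [he, star_add, star_one, ← Unitization.inr_star, hc.star_eq]
  refine ⟨x + c + x * c, isQuasiUnitary_iff_mem_unitary.2 ?_, ?_⟩
  · have hy : (1 + ((x + c + x * c : C) : Unitization ℂ C)) = u * e := by
      simp only [hu, he, Unitization.inr_add, Unitization.inr_mul]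
      noncomm_ring
    rw [hy, Unitary.mem_iff, star_mul, hes]
    have hl : e * star u * (u * e) = 1 := by rw [← hcbc]; noncomm_ring
    refine ⟨hl, ?_⟩
    -- Both sides are inverses of `g`, one from the left and one from the right, hence equal.
    have hgc : g * (u * star u) = u * star u * g :=
      left_inv_eq_right_inv hd (by rw [← hd]; simp only [mul_assoc])
    have hr : u * e * (star u * u * e * (star u * g * g)) = 1 :=
      calc u * e * (star u * u * e * (star u * g * g))
          = u * (e * (star u * u) * e) * (star u * g * g) := by noncomm_ring
        _ = u * star u * g * g := by rw [hcbc]; noncomm_ring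
        _ = 1 := by rw [← hgc, hd]
    rw [left_inv_eq_right_inv hl hr, hr]
  · have : x + c + x * c - x = c + x * c := by abel
    rw [this]
    calc ‖c + x * c‖ ≤ ‖c‖ + ‖x‖ * ‖c‖ := (norm_add_le _ _).trans (by gcongr; exact norm_mul_le _ _)
      _ ≤ δ + ‖x‖ * δ := by gcongr
      _ = _ := by ring

end QuasiUnitary

/-! ### The universal property of `Σ`. -/

section Universal

variable {C D : Type*} [NonUnitalCStarAlgebra C] [NonUnitalCStarAlgebra D]

theorem continuous_of_starHom (f : C →⋆ₙₐ[ℂ] D) : Continuous f :=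
  AddMonoidHomClass.continuous_of_bound f 1 fun a => by
    simpa using NonUnitalStarAlgHom.norm_apply_le f a

theorem isQuasiUnitary_omega : IsQuasiUnitary omega := by
  have h : ∀ z : Circle, star ((z : ℂ) - 1) * ((z : ℂ) - 1) + ((z : ℂ) - 1) +
      star ((z : ℂ) - 1) = 0 := fun z => by
    have h1 : star (z : ℂ) * z = 1 := by
      rw [Complex.star_def, ← Complex.normSq_eq_conj_mul_self, Circle.normSq_coe,
        Complex.ofReal_one]
    rw [star_sub, star_one]
    linear_combination h1
  have h' : ∀ z : Circle, ((z : ℂ) - 1) * star ((z : ℂ) - 1) + ((z : ℂ) - 1) +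
      star ((z : ℂ) - 1) = 0 := fun z => by
    rw [mul_comm, h]
  exact ⟨Subtype.ext (ContinuousMap.ext h), Subtype.ext (ContinuousMap.ext h')⟩

/-- The pullback of functions along `z ↦ z + 1`, from the circle to a subset of the
translated circle. -/
def CircleSusp.pullback (s : Set ℂ) [Fact (0 ∈ s)] (hs : ∀ z ∈ s, ‖z + 1‖ = 1) :
    CircleSusp →⋆ₙₐ[ℂ] C(s, ℂ)₀ where
  toFun φ := ⟨⟨fun z => φ.1 ⟨z + 1, mem_sphere_zero_iff_norm.2 (hs z z.2)⟩,
    φ.1.continuous.comp (continuous_induced_rng.2 (by fun_prop))⟩, by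
      refine (congrArg φ.1 (Circle.ext ?_)).trans φ.2
      change (0 : ℂ) + 1 = 1
      rw [zero_add]⟩
  map_smul' _ _ := rfl
  map_zero' := rfl
  map_add' _ _ := rfl
  map_mul' _ _ := rfl
  map_star' _ := rfl

theorem CircleSusp.pullback_omega (s : Set ℂ) [Fact (0 ∈ s)] (hs : ∀ z ∈ s, ‖z + 1‖ = 1) :
    CircleSusp.pullback s hs omega = ContinuousMapZero.id s := by
  ext z
  change ((z : ℂ) + 1) - 1 = z
  ring

/-- The algebra `Σ` contains the universal quasi-unitary element: existence. -/
theorem exists_starHom_omega {x : C} (hx : IsQuasiUnitary x) :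
    ∃ h : CircleSusp →⋆ₙₐ[ℂ] C, h omega = x := by
  have hn := hx.isStarNormal
  refine ⟨(cfcₙHom (R := ℂ) hn).comp (CircleSusp.pullback (quasispectrum ℂ x) fun z hz =>
    hx.norm_add_one_of_mem_quasispectrum hz), ?_⟩
  rw [NonUnitalStarAlgHom.comp_apply, CircleSusp.pullback_omega]
  exact cfcₙHom_id hn

/-- The circle of radius `1` around `-1`. -/
def shiftedCircle : Set ℂ := Metric.sphere (-1) 1

instance : Fact ((0 : ℂ) ∈ shiftedCircle) := ⟨by simp [shiftedCircle]⟩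

instance : CompactSpace shiftedCircle := isCompact_iff_compactSpace.1 (isCompact_sphere _ _)

/-- The pullback of functions along `z ↦ z - 1`. -/
def CircleSusp.ofShifted : C(shiftedCircle, ℂ)₀ →⋆ₙₐ[ℂ] CircleSusp where
  toFun f := ⟨⟨fun z => f ⟨(z : ℂ) - 1, by
    simpa [shiftedCircle] using z.norm_coe⟩, by fun_prop⟩, by
    refine (congrArg f (Subtype.ext ?_)).trans (map_zero f)
    change ((1 : Circle) : ℂ) - 1 = 0
    simp⟩
  map_smul' _ _ := rfl
  map_zero' := rfl
  map_add' _ _ := rfl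
  map_mul' _ _ := rfl
  map_star' _ := rfl

/-- The algebra `Σ` contains the universal quasi-unitary element: uniqueness. -/
theorem starHom_ext_omega {h h' : CircleSusp →⋆ₙₐ[ℂ] C} (e : h omega = h' omega) : h = h' := by
  have hcirc : ∀ z ∈ shiftedCircle, ‖z + 1‖ = 1 := fun z hz => by
    simpa [shiftedCircle, dist_eq_norm] using hz
  have hid : CircleSusp.ofShifted (ContinuousMapZero.id shiftedCircle) = omega := rfl
  have hcont : Continuous CircleSusp.ofShifted :=
    AddMonoidHomClass.continuous_of_bound CircleSusp.ofShifted 1 fun a => by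
      rw [one_mul, ContinuousMapZero.norm_def]
      exact (ContinuousMap.norm_le _ (norm_nonneg _)).2 fun z =>
        ContinuousMap.norm_coe_le_norm (a : C(shiftedCircle, ℂ)) _
  -- On functions vanishing at `0` on the shifted circle, `ω` becomes the identity function, and a
  -- continuous *-homomorphism is determined by its value there (Stone–Weierstrass).
  have key : h.comp CircleSusp.ofShifted = h'.comp CircleSusp.ofShifted := by
    apply ContinuousMapZero.UniqueHom.eq_of_continuous_of_map_id shiftedCircle
    · exact (continuous_of_starHom h).comp hcont
    · exact (continuous_of_starHom h').comp hcont
    · rw [NonUnitalStarAlgHom.comp_apply, NonUnitalStarAlgHom.comp_apply, hid, e]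
    all_goals infer_instance
  refine NonUnitalStarAlgHom.ext fun φ => ?_
  have hφ : CircleSusp.ofShifted (CircleSusp.pullback shiftedCircle hcirc φ) = φ :=
    Subtype.ext (ContinuousMap.ext fun z =>
      congrArg φ.1 (Circle.ext (sub_add_cancel (z : ℂ) 1)))
  rw [← hφ]
  exact DFunLike.congr_fun key _

end Universal

/-! ### Lifting quasi-unitaries from sequence algebras and from the stabilisation. -/

section Lifting

variable {A : ℕ → Type*} [∀ n, NonUnitalCStarAlgebra (A n)]

/-- The class of a sequence of quasi-unitary elements. -/
def quSeq (x : ∀ n, A n) (hx : ∀ n, IsQuasiUnitary (x n)) : lp A ∞ :=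
  ⟨x, memℓp_infty ⟨2, by rintro _ ⟨n, rfl⟩; exact (hx n).norm_le⟩⟩

theorem isQuasiUnitary_cls_quSeq (x : ∀ n, A n) (hx : ∀ n, IsQuasiUnitary (x n)) :
    IsQuasiUnitary (SeqAlg.cls (quSeq x hx)) := by
  constructor
  · exact congrArg SeqAlg.cls (show star (quSeq x hx) * quSeq x hx + quSeq x hx +
      star (quSeq x hx) = 0 from lp.ext (funext fun n => (hx n).1))
  · exact congrArg SeqAlg.cls (show quSeq x hx * star (quSeq x hx) + quSeq x hx +
      star (quSeq x hx) = 0 from lp.ext (funext fun n => (hx n).2))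

/-- Quasi-unitary elements of `∏ₙ Aₙ / ⨁ₙ Aₙ` lift to sequences of quasi-unitary elements. -/
theorem exists_quSeq {q : SeqAlg A} (hq : IsQuasiUnitary q) :
    ∃ (x : ∀ n, A n) (hx : ∀ n, IsQuasiUnitary (x n)), SeqAlg.cls (quSeq x hx) = q := by
  obtain ⟨a, rfl⟩ := SeqAlg.cls_surjective q
  have h1 : Tendsto (fun n => ‖star (a n) * a n + a n + star (a n)‖) atTop (𝓝 0) := by
    have : SeqAlg.cls (star a * a + a + star a) = SeqAlg.cls 0 := hq.1
    rw [SeqAlg.cls_eq_iff, sub_zero, mem_nullSeq] at this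
    exact this
  have h2 : Tendsto (fun n => ‖a n * star (a n) + a n + star (a n)‖) atTop (𝓝 0) := by
    have : SeqAlg.cls (a * star a + a + star a) = SeqAlg.cls 0 := hq.2
    rw [SeqAlg.cls_eq_iff, sub_zero, mem_nullSeq] at this
    exact this
  let δ : ℕ → ℝ := fun n => max ‖star (a n) * a n + a n + star (a n)‖
    ‖a n * star (a n) + a n + star (a n)‖
  have hδ : Tendsto δ atTop (𝓝 0) := by simpa using h1.max h2
  have hex : ∀ n, ∃ y : A n, IsQuasiUnitary y ∧ (δ n ≤ 1 / 2 → ‖y - a n‖ ≤ δ n * (1 + ‖a‖)) := by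
    intro n
    by_cases hn : δ n ≤ 1 / 2
    · obtain ⟨y, hy, hyx⟩ := exists_isQuasiUnitary_near hn (le_max_left _ _) (le_max_right _ _)
      have h0 : 0 ≤ δ n := (norm_nonneg _).trans (le_max_left _ _)
      exact ⟨y, hy, fun _ => hyx.trans (by gcongr; exact norm_coe_le a n)⟩
    -- Only finitely many `n` have a large defect. Their entries do not affect the class, so `0`
    -- serves.
    · exact ⟨0, isQuasiUnitary_zero, fun h => absurd h hn⟩
  choose x hx hxa using hex
  refine ⟨x, hx, SeqAlg.cls_eq_iff.2 (mem_nullSeq.2 ?_)⟩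
  refine squeeze_zero' (.of_forall fun n => norm_nonneg _) ?_
    (g := fun n => δ n * (1 + ‖a‖)) (by simpa using hδ.mul_const (1 + ‖a‖))
  filter_upwards [hδ.eventually (ge_mem_nhds (show (0 : ℝ) < 1 / 2 by norm_num))] with n hn
  exact hxa n hn

variable {B : Type*} [NonUnitalCStarAlgebra B]

/-- Quasi-unitary elements of `B ⊗ 𝒦` are approximated by those of the matrix algebras. -/
theorem exists_isQuasiUnitary_incl_near {x : Stab B} (hx : IsQuasiUnitary x) {ε : ℝ}
    (hε : 0 < ε) : ∃ (k : ℕ) (y : Mat k B), IsQuasiUnitary y ∧ ‖Stab.incl k y - x‖ < ε := by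
  -- The factor `4` bounds `1 + ‖a‖` for the approximant `a`, whose norm will be below `3`. The
  -- other half of `ε` pays for replacing `x` by `a`.
  obtain ⟨δ, hδ, hδ1, hδ2⟩ : ∃ δ : ℝ, 0 < δ ∧ δ ≤ 1 / 2 ∧ δ * 4 ≤ ε / 2 :=
    ⟨min (1 / 2) (ε / 8), by positivity, min_le_left _ _, by
      have := min_le_right (1 / 2) (ε / 8); linarith⟩
  let U : Set (Stab B) := {z | ‖z - x‖ < ε / 2 ∧ ‖z‖ < 3 ∧ ‖star z * z + z + star z‖ < δ ∧
    ‖z * star z + z + star z‖ < δ}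
  have hU : IsOpen U := by
    refine (isOpen_lt ?_ continuous_const).and <| (isOpen_lt ?_ continuous_const).and <|
      (isOpen_lt ?_ continuous_const).and (isOpen_lt ?_ continuous_const) <;> fun_prop
  have hxU : x ∈ U := by
    refine ⟨by simpa using hε, lt_of_le_of_lt hx.norm_le (by norm_num), ?_, ?_⟩
    · rw [hx.1, norm_zero]; exact hδ
    · rw [hx.2, norm_zero]; exact hδ
  obtain ⟨z, ⟨hz1, hz2, hz3, hz4⟩, hz⟩ := Stab.dense_incl.inter_open_nonempty U hU ⟨x, hxU⟩
  obtain ⟨k, a, rfl⟩ := Set.mem_iUnion.1 hz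
  -- Since the inclusion is isometric, the defect of `a` is as small in `M_k(B)` as in `B ⊗ 𝒦`, so
  -- the correction can be made inside `M_k(B)`.
  simp only [← map_star, ← map_mul, ← map_add, Stab.norm_incl] at hz2 hz3 hz4
  obtain ⟨y, hy, hya⟩ := exists_isQuasiUnitary_near hδ1 hz3.le hz4.le
  refine ⟨k, y, hy, ?_⟩
  have h1 : ‖Stab.incl k y - Stab.incl k a‖ ≤ ε / 2 := by
    rw [← map_sub, Stab.norm_incl]
    refine (hya.trans ?_).trans hδ2
    gcongr
    linarith
  calc ‖Stab.incl k y - x‖ ≤ ‖Stab.incl k y - Stab.incl k a‖ + ‖Stab.incl k a - x‖ :=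
        norm_sub_le_norm_sub_add_norm_sub _ _ _
    _ < ε := by linarith

end Lifting

/-! ### Connecting nearby quasi-unitaries. -/

section Paths

open unitInterval

variable {C : Type*} [NonUnitalCStarAlgebra C]

/-- Quasi-unitary elements at distance less than `2` are joined by a path of quasi-unitaries. -/
theorem exists_path_of_norm_sub_lt {x y : C} (hx : IsQuasiUnitary x) (hy : IsQuasiUnitary y)
    (hxy : ‖y - x‖ < 2) :
    ∃ γ : C(I, C), (∀ t, IsQuasiUnitary (γ t)) ∧ γ 0 = x ∧ γ 1 = y := by
  rw [isQuasiUnitary_iff_mem_unitary] at hx hy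
  obtain ⟨p⟩ := Unitary.joined (⟨_, hx⟩ : unitary (Unitization ℂ C)) ⟨_, hy⟩ (by
    simpa [← Unitization.inr_sub, Unitization.norm_inr] using hxy)
  have hcont : Continuous fun t => (p t : Unitization ℂ C) :=
    continuous_subtype_val.comp p.continuous
  have hfst := Unitization.continuous_fst.comp hcont
  have hsnd := Unitization.continuous_snd.comp hcont
  -- The path in the unitization may leave the unitaries with scalar part `1`. Its scalar part has
  -- modulus `1`, so multiplying by the conjugate brings the path back, and leaves the end points
  -- fixed because their scalar part is already `1`.
  refine ⟨⟨fun t => star (p t : Unitization ℂ C).fst • (p t : Unitization ℂ C).snd,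
    (continuous_star.comp hfst).smul hsnd⟩, fun t => ?_, ?_, ?_⟩
  · obtain ⟨h1, h2⟩ := Unitary.mem_iff.1 (p t).2
    have ha : star (p t : Unitization ℂ C).fst * (p t : Unitization ℂ C).fst = 1 := 
      congrArg (fun q : Unitization ℂ C => q.fst) h1
    change IsQuasiUnitary (star (p t : Unitization ℂ C).fst • (p t : Unitization ℂ C).snd)
    generalize (p t : Unitization ℂ C) = q at *
    have hq : 1 + ((star q.fst • q.snd : C) : Unitization ℂ C) = star q.fst • q := by
      ext
      · simpa using ha.symm
      · simp
    rw [isQuasiUnitary_iff_mem_unitary, hq, Unitary.mem_iff, star_smul, star_star,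
      smul_mul_smul_comm, smul_mul_smul_comm, h1, h2, ha, mul_comm, ha, one_smul]
    exact ⟨rfl, rfl⟩
  · simp
  · simp

end Paths

/-! ### Dictionary between `U_k⁺(B)`, quasi-unitaries of `M_k(B)`, and `K₁(B)`. -/

section Unitaries

open unitInterval

variable {B : Type*} [NonUnitalCStarAlgebra B] {k : ℕ}

variable (B k) in
/-- The entrywise inclusion `M_k(B) → M_k(B₊)`. -/
def matInr : Mat k B →⋆ₙₐ[ℂ] UMat B k :=
  CStarMatrix.mapₙₐ (n := Fin k) (Unitization.inrNonUnitalStarAlgHom ℂ B)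

theorem matInr_apply (x : Mat k B) (i j : Fin k) :
    matInr B k x i j = Unitization.inr ((x : CStarMatrix (Fin k) (Fin k) B) i j) := rfl

theorem matInr_injective : Function.Injective (matInr B k) := fun _ _ h =>
  CStarMatrix.ext fun i j => Unitization.inr_injective (congrFun (congrFun h i) j)

theorem UPlus.val_eq (u : UPlus B k) : u.val = 1 + matInr B k u.subOne := by
  rw [← sub_eq_iff_eq_add']
  exact CStarMatrix.ext fun i j => Unitization.ext (u.2 i j) rfl

theorem UPlus.subOne_injective : Function.Injective (UPlus.subOne (B := B) (k := k)) :=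
  fun u v h => UPlus.val_injective (by rw [u.val_eq, v.val_eq, h])

theorem UPlus.subOne_one : UPlus.subOne (1 : UPlus B k) = 0 :=
  matInr_injective (by rw [map_zero, ← add_eq_left, ← UPlus.val_eq, UPlus.val_one])

theorem UPlus.subOne_mul (u v : UPlus B k) :
    (u * v).subOne = u.subOne + v.subOne + u.subOne * v.subOne := by
  refine matInr_injective (add_left_cancel (a := 1) ?_)
  rw [← UPlus.val_eq, UPlus.val_mul, UPlus.val_eq, UPlus.val_eq, map_add, map_add, map_mul]
  noncomm_ring

/-- A separate statement from `isQuasiUnitary_iff_mem_unitary`, because `M_k(B₊)` is in general not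
the unitization of `M_k(B)`. -/
theorem mem_unitary_iff_isQuasiUnitary {x : Mat k B} :
    1 + matInr B k x ∈ unitary (UMat B k) ↔ IsQuasiUnitary x := by
  have e1 : star (1 + matInr B k x) * (1 + matInr B k x) =
      1 + matInr B k (star x * x + x + star x) := by
    simp only [star_add, star_one, map_add, map_mul, map_star]
    noncomm_ring
  have e2 : (1 + matInr B k x) * star (1 + matInr B k x) =
      1 + matInr B k (x * star x + x + star x) := by
    simp only [star_add, star_one, map_add, map_mul, map_star]
    noncomm_ring
  rw [Unitary.mem_iff, e1, e2, add_eq_left, add_eq_left, map_eq_zero_iff _ matInr_injective,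
    map_eq_zero_iff _ matInr_injective]
  rfl

theorem UPlus.isQuasiUnitary_subOne (u : UPlus B k) : IsQuasiUnitary u.subOne := by
  rw [← mem_unitary_iff_isQuasiUnitary, ← UPlus.val_eq]
  exact u.1.2

/-- The unitary `1 + x ∈ U_k⁺(B)` for a quasi-unitary `x ∈ M_k(B)`. -/
def UPlus.ofQuasiUnitary (x : Mat k B) (hx : IsQuasiUnitary x) : UPlus B k :=
  ⟨⟨1 + matInr B k x, mem_unitary_iff_isQuasiUnitary.2 hx⟩, fun i j => by
    change ((1 + matInr B k x - 1) i j).fst = 0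
    rw [add_sub_cancel_left, matInr_apply, Unitization.fst_inr]⟩

theorem UPlus.subOne_ofQuasiUnitary (x : Mat k B) (hx : IsQuasiUnitary x) :
    (UPlus.ofQuasiUnitary x hx).subOne = x :=
  matInr_injective (add_left_cancel (a := 1) (by rw [← UPlus.val_eq]; rfl))

theorem UPlus.subOne_stab {n : ℕ} (h : k ≤ n) (u : UPlus B k) :
    (UPlus.stab h u).subOne = padHom h u.subOne := by
  refine matInr_injective (add_left_cancel (a := 1) ?_)
  rw [← UPlus.val_eq, UPlus.val_stab, UPlus.val_eq, add_sub_cancel_left]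
  refine congrArg (1 + ·) (CStarMatrix.ext fun i j => ?_)
  rw [matInr_apply]
  change (if h : (i : ℕ) < k ∧ (j : ℕ) < k then
      Unitization.inr ((u.subOne : CStarMatrix (Fin k) (Fin k) B) ⟨i, h.1⟩ ⟨j, h.2⟩) else 0) =
    Unitization.inr (if h : (i : ℕ) < k ∧ (j : ℕ) < k then
      (u.subOne : CStarMatrix (Fin k) (Fin k) B) ⟨i, h.1⟩ ⟨j, h.2⟩ else 0)
  split_ifs <;> rfl

theorem incl_padHom {n : ℕ} (h : k ≤ n) (x : Mat k B) :
    Stab.incl n (padHom h x) = Stab.incl k x :=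
  Subtype.ext (cornerHom_padHom h x)

theorem Mat.continuous_iff {X : Type*} [TopologicalSpace X] {γ : X → Mat k B} :
    Continuous γ ↔ ∀ i j, Continuous fun t => (γ t : CStarMatrix (Fin k) (Fin k) B) i j := by
  refine Iff.trans ?_ (continuous_pi_iff.trans (forall_congr' fun i => continuous_pi_iff))
  rfl

/-- Turns entrywise continuous paths of unitaries into norm-continuous elements of `C([0,1],
M_k(B))`, the form in which asymptotic homotopies use them. -/
theorem UPlus.homotopic_iff {u v : UPlus B k} :
    UPlus.Homotopic u v ↔ ∃ γ : C(I, Mat k B), (∀ t, IsQuasiUnitary (γ t)) ∧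
      γ 0 = u.subOne ∧ γ 1 = v.subOne := by
  constructor
  · rintro ⟨γ, hγ, rfl, rfl⟩
    refine ⟨⟨fun t => (γ t).subOne, Mat.continuous_iff.2 fun i j => ?_⟩,
      fun t => (γ t).isQuasiUnitary_subOne, rfl, rfl⟩
    exact Unitization.continuous_snd.comp ((hγ i j).sub continuous_const)
  · rintro ⟨γ, hγ, h0, h1⟩
    refine ⟨fun t => UPlus.ofQuasiUnitary (γ t) (hγ t), fun i j => ?_, ?_, ?_⟩
    · exact continuous_const.add
        (Unitization.continuous_inr.comp (Mat.continuous_iff.1 γ.continuous i j))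
    · exact UPlus.subOne_injective (by rw [UPlus.subOne_ofQuasiUnitary, h0])
    · exact UPlus.subOne_injective (by rw [UPlus.subOne_ofQuasiUnitary, h1])

theorem UPlus.Homotopic.symm {u v : UPlus B k} (h : UPlus.Homotopic u v) :
    UPlus.Homotopic v u := by
  obtain ⟨γ, hγ, rfl, rfl⟩ := h
  exact ⟨fun t => γ (σ t), fun i j => (hγ i j).comp continuous_symm, by simp, by simp⟩

theorem KOne.cls_stab {n : ℕ} (h : k ≤ n) (u : UPlus B k) :
    KOne.cls ⟨n, UPlus.stab h u⟩ = KOne.cls ⟨k, u⟩ :=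
  congrArg (fun x => Additive.ofMul (QuotientGroup.mk (s := UInfZero B) x)) (UInf.mk_stab h u)

theorem KOne.cls_one (k : ℕ) : KOne.cls ⟨k, (1 : UPlus B k)⟩ = 0 :=
  congrArg (fun x => Additive.ofMul (QuotientGroup.mk (s := UInfZero B) x)) (UInf.mk_one k)

theorem KOne.cls_mul (u v : UPlus B k) :
    KOne.cls ⟨k, u * v⟩ = KOne.cls ⟨k, u⟩ + KOne.cls ⟨k, v⟩ :=
  congrArg (fun x => Additive.ofMul (QuotientGroup.mk (s := UInfZero B) x)) (UInf.mk_mul k u v)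

theorem KOne.cls_surjective : Function.Surjective (KOne.cls (B := B)) := by
  intro x
  obtain ⟨y, hy⟩ := QuotientGroup.mk_surjective (s := UInfZero B) x.toMul
  obtain ⟨k, u, rfl⟩ := UInf.exists_eq_mk y
  exact ⟨⟨k, u⟩, congrArg Additive.ofMul hy⟩

theorem KOne.cls_eq_of_homotopic {u v : UPlus B k} (h : UPlus.Homotopic u v) :
    KOne.cls ⟨k, u⟩ = KOne.cls ⟨k, v⟩ := by
  refine congrArg Additive.ofMul (QuotientGroup.eq.2 ?_).symm
  refine ⟨k, v⁻¹ * u, ?_, ?_⟩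
  · simpa using (UPlus.Homotopic.refl v⁻¹).mul h
  · rw [UInf.mk_mul, UInf.mk_inv]

theorem UInf.mk_injective : Function.Injective (UInf.mk (B := B) k) := by
  intro u v h
  obtain ⟨n, h1, h2, e⟩ := Quotient.exact h
  refine UPlus.subOne_injective (Stab.padHom_injective h1 ?_)
  rw [← UPlus.subOne_stab, ← UPlus.subOne_stab]
  exact congrArg UPlus.subOne e

/-- Equality in `K₁` says that `u⁻¹v` is represented by some `w` connected to `1`. At a size
accommodating `u`, `v` and `w`, injectivity of the matrix stages in the limit gives `v = uw`, and
`w` is then contracted. -/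
theorem KOne.exists_homotopic_stab {l : ℕ} {u : UPlus B k} {v : UPlus B l}
    (h : KOne.cls ⟨k, u⟩ = KOne.cls ⟨l, v⟩) : ∃ (n : ℕ) (hk : k ≤ n) (hl : l ≤ n),
      UPlus.Homotopic (UPlus.stab hk u) (UPlus.stab hl v) := by
  obtain ⟨m, w, hw, e⟩ := QuotientGroup.eq.1 (Additive.ofMul.injective h)
  have hk : k ≤ max (max k l) m := (le_max_left _ _).trans (le_max_left _ _)
  have hl : l ≤ max (max k l) m := (le_max_right _ _).trans (le_max_left _ _)
  have hm : m ≤ max (max k l) m := le_max_right _ _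
  refine ⟨max (max k l) m, hk, hl, ?_⟩
  have hv : UPlus.stab hl v = UPlus.stab hk u * UPlus.stab hm w := by
    apply UInf.mk_injective
    rw [UInf.mk_mul, UInf.mk_stab, UInf.mk_stab, UInf.mk_stab]
    exact inv_mul_eq_iff_eq_mul.1 e
  rw [hv]
  simpa using (UPlus.Homotopic.refl (UPlus.stab hk u)).mul (hw.stab hm).symm

end Unitaries

/-! ### Asymptotic homotopy corresponds to eventual equality in `K₁`. -/

section Comparison

open unitInterval

variable {A B : Type*} [NonUnitalCStarAlgebra A] [NonUnitalCStarAlgebra B]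

theorem KOne.cls_eq_of_norm_sub_lt {u v : Σ k, UPlus B k}
    (h : ‖Stab.incl v.1 v.2.subOne - Stab.incl u.1 u.2.subOne‖ < 2) :
    KOne.cls u = KOne.cls v := by
  obtain ⟨k, u⟩ := u
  obtain ⟨l, v⟩ := v
  rw [← KOne.cls_stab (le_max_left k l), ← KOne.cls_stab (le_max_right k l) v]
  refine KOne.cls_eq_of_homotopic (UPlus.homotopic_iff.2 ?_)
  refine exists_path_of_norm_sub_lt (UPlus.isQuasiUnitary_subOne _)
    (UPlus.isQuasiUnitary_subOne _) ?_
  rwa [← Stab.norm_incl, map_sub, UPlus.subOne_stab, UPlus.subOne_stab, incl_padHom, incl_padHom]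

theorem exists_uPlus_near {x : Stab B} (hx : IsQuasiUnitary x) {ε : ℝ} (hε : 0 < ε) :
    ∃ u : Σ k, UPlus B k, ‖Stab.incl u.1 u.2.subOne - x‖ < ε := by
  obtain ⟨k, y, hy, hyx⟩ := exists_isQuasiUnitary_incl_near hx hε
  exact ⟨⟨k, .ofQuasiUnitary y hy⟩, by rwa [UPlus.subOne_ofQuasiUnitary]⟩

/-- Unitaries close to the end points of a path of quasi-unitaries of `B ⊗ 𝒦` have the same
class in `K₁(B)`. -/
theorem KOne.cls_eq_of_path {γ : C(I, Stab B)} (hγ : ∀ t, IsQuasiUnitary (γ t))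
    {u v : Σ k, UPlus B k} (hu : ‖Stab.incl u.1 u.2.subOne - γ 0‖ < 1 / 2)
    (hv : ‖Stab.incl v.1 v.2.subOne - γ 1‖ < 1 / 2) : KOne.cls u = KOne.cls v := by
  choose w hw using fun t => exists_uPlus_near (hγ t) (ε := 1 / 2) (by norm_num)
  have close : ∀ (a b : Σ k, UPlus B k) (s t : I), ‖Stab.incl a.1 a.2.subOne - γ s‖ < 1 / 2 →
      ‖Stab.incl b.1 b.2.subOne - γ t‖ < 1 / 2 → dist (γ t) (γ s) < 1 →
      KOne.cls a = KOne.cls b := fun a b s t ha hb hst => by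
    refine KOne.cls_eq_of_norm_sub_lt ?_
    rw [← dist_eq_norm] at ha hb ⊢
    calc _ ≤ dist (Stab.incl b.1 b.2.subOne) (γ t) + dist (γ t) (γ s) +
          dist (γ s) (Stab.incl a.1 a.2.subOne) := dist_triangle4 _ _ _ _
      _ < 1 / 2 + 1 + 1 / 2 := by rw [dist_comm (γ s)]; gcongr
      _ = 2 := by norm_num
  -- A path in `B ⊗ 𝒦` need not stay in any one matrix algebra, so each point is approximated
  -- separately. The tolerances add up to `1/2 + 1 + 1/2 = 2`, the distance below which classes
  -- agree, and connectedness of the interval does the rest.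
  have hloc : IsLocallyConstant fun t => KOne.cls (w t) := by
    rw [IsLocallyConstant.iff_eventually_eq]
    intro s
    filter_upwards [γ.continuous.continuousAt.eventually (Metric.ball_mem_nhds (γ s) one_pos)]
      with t ht
    exact (close _ _ s t (hw s) (hw t) ht).symm
  calc KOne.cls u = KOne.cls (w 0) := close _ _ 0 0 hu (hw 0) (by simp)
    _ = KOne.cls (w 1) := hloc.apply_eq_of_isPreconnected isPreconnected_univ trivial trivial
    _ = KOne.cls v := close _ _ 1 1 (hw 1) hv (by simp)

theorem isQuasiUnitary_of_forall {γ : C(I, A)} (hγ : ∀ t, IsQuasiUnitary (γ t)) :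
    IsQuasiUnitary γ :=
  ⟨ContinuousMap.ext fun t => (hγ t).1, ContinuousMap.ext fun t => (hγ t).2⟩

theorem isQuasiUnitary_subOneCls (u : ℕ → Σ k, UPlus B k) : IsQuasiUnitary (subOneCls u) :=
  isQuasiUnitary_cls_quSeq _ fun n => (u n).2.isQuasiUnitary_subOne.map (Stab.incl (u n).1)

/-- Every discrete asymptotic homomorphism from `Σ` to `B ⊗ 𝒦` is given by a sequence of
unitaries. -/
theorem exists_eq_subOneCls (h : CircleSusp →⋆ₙₐ[ℂ] ADelta (Stab B)) :
    ∃ u : ℕ → Σ k, UPlus B k, h omega = subOneCls u := by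
  obtain ⟨x, hx, e⟩ := exists_quSeq (isQuasiUnitary_omega.map h)
  choose u hu using fun n => exists_uPlus_near (hx n) (ε := 1 / ((n : ℝ) + 1)) (by positivity)
  refine ⟨u, e.symm.trans (Eq.symm (SeqAlg.cls_eq_iff.2 (mem_nullSeq.2 ?_)))⟩
  exact squeeze_zero (fun n => norm_nonneg _) (fun n => (hu n).le)
    tendsto_one_div_add_atTop_nhds_zero_nat

/-- For each good `n` a path in a matrix algebra joins the two unitaries. The sequence of these
paths is one quasi-unitary of `𝒜_δ C([0,1], B ⊗ 𝒦)`, and universality of `ω` turns it into the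
homotopy. Matrix sizes and moduli of continuity may vary freely with `n`. -/
theorem asympHomotopic_of_cls_eq {u v : ℕ → Σ k, UPlus B k}
    (huv : ∀ᶠ n in atTop, KOne.cls (u n) = KOne.cls (v n))
    {h h' : CircleSusp →⋆ₙₐ[ℂ] ADelta (Stab B)} (hu : h omega = subOneCls u)
    (hv : h' omega = subOneCls v) : AsympHomotopic h h' := by
  have hex : ∀ n, ∃ γ : C(I, Stab B), IsQuasiUnitary γ ∧ (KOne.cls (u n) = KOne.cls (v n) →
      γ 0 = subOneSeq u n ∧ γ 1 = subOneSeq v n) := by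
    intro n
    by_cases hn : KOne.cls (u n) = KOne.cls (v n)
    · obtain ⟨m, hk, hl, hm⟩ := KOne.exists_homotopic_stab hn
      obtain ⟨γ, hγ, h0, h1⟩ := UPlus.homotopic_iff.1 hm
      refine ⟨postcomp (Stab.incl m) γ,
        (isQuasiUnitary_of_forall hγ).map (postcomp (Stab.incl m)), fun _ => ⟨?_, ?_⟩⟩
      · change Stab.incl m (γ 0) = Stab.incl (u n).1 (u n).2.subOne
        rw [h0, UPlus.subOne_stab, incl_padHom]
      · change Stab.incl m (γ 1) = Stab.incl (v n).1 (v n).2.subOne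
        rw [h1, UPlus.subOne_stab, incl_padHom]
    · exact ⟨0, isQuasiUnitary_zero, fun e => absurd e hn⟩
  choose γ hγ hγe using hex
  obtain ⟨H, hH⟩ := exists_starHom_omega (isQuasiUnitary_cls_quSeq γ hγ)
  refine ⟨H, starHom_ext_omega ?_, starHom_ext_omega ?_⟩
  · rw [hu, NonUnitalStarAlgHom.comp_apply, hH]
    refine SeqAlg.cls_eq_iff.2 (mem_nullSeq.2 (tendsto_const_nhds.congr' ?_))
    filter_upwards [huv] with n hn
    change 0 = ‖γ n 0 - subOneSeq u n‖
    rw [(hγe n hn).1, sub_self, norm_zero]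
  · rw [hv, NonUnitalStarAlgHom.comp_apply, hH]
    refine SeqAlg.cls_eq_iff.2 (mem_nullSeq.2 (tendsto_const_nhds.congr' ?_))
    filter_upwards [huv] with n hn
    change 0 = ‖γ n 1 - subOneSeq v n‖
    rw [(hγe n hn).2, sub_self, norm_zero]

/-- Lifting `H(ω)` over the function algebra `C([0,1], B ⊗ 𝒦)` yields genuine paths of
quasi-unitaries, one for each `n`. Their end points differ from the given unitaries by null
sequences. -/
theorem AsympHomotopic.eventually_cls_eq {h h' : CircleSusp →⋆ₙₐ[ℂ] ADelta (Stab B)}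
    (hh : AsympHomotopic h h') {u v : ℕ → Σ k, UPlus B k} (hu : h omega = subOneCls u)
    (hv : h' omega = subOneCls v) : ∀ᶠ n in atTop, KOne.cls (u n) = KOne.cls (v n) := by
  obtain ⟨H, rfl, rfl⟩ := hh
  obtain ⟨γ, hγ, e⟩ := exists_quSeq (isQuasiUnitary_omega.map H)
  rw [NonUnitalStarAlgHom.comp_apply, ← e] at hu hv
  have h0 : Tendsto (fun n => ‖subOneSeq u n - γ n 0‖) atTop (𝓝 0) :=
    mem_nullSeq.1 (SeqAlg.cls_eq_iff.1 hu.symm)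
  have h1 : Tendsto (fun n => ‖subOneSeq v n - γ n 1‖) atTop (𝓝 0) :=
    mem_nullSeq.1 (SeqAlg.cls_eq_iff.1 hv.symm)
  have hhalf : (0 : ℝ) < 1 / 2 := by norm_num
  filter_upwards [h0.eventually (gt_mem_nhds hhalf), h1.eventually (gt_mem_nhds hhalf)]
    with n hn0 hn1
  exact KOne.cls_eq_of_path (fun t => (hγ n).map (ev t)) hn0 hn1

end Comparison

/-! ### Concatenation in the suspension coordinate and addition in `K₁`. -/

section Suspension

open unitInterval

variable {B C : Type*} [NonUnitalCStarAlgebra B] [NonUnitalCStarAlgebra C] {k : ℕ}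

/-- Functoriality of `U_k⁺`. -/
def UPlus.map (f : B →⋆ₙₐ[ℂ] C) (u : UPlus B k) : UPlus C k :=
  .ofQuasiUnitary (Stab.matMap f k u.subOne) (u.isQuasiUnitary_subOne.map _)

theorem UPlus.subOne_map (f : B →⋆ₙₐ[ℂ] C) (u : UPlus B k) :
    (u.map f).subOne = Stab.matMap f k u.subOne := UPlus.subOne_ofQuasiUnitary _ _

/-- The interval is convex, so the straight line from `p` to the identity consists of self-maps
fixing both end points, and each of them acts on `ΣB`. -/
theorem UPlus.homotopic_map_reparam (p : C(I, I)) (h0 : p 0 = 0) (h1 : p 1 = 1)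
    (u : UPlus (Susp B) k) : UPlus.Homotopic (u.map (Susp.reparam p h0 h1)) u := by
  let P : C(I × I, I) := ⟨fun s => ⟨(1 - s.1) * p s.2 + s.1 * s.2, by
    have a := s.1.2; have b := (p s.2).2; have c := s.2.2
    constructor
    · have := mul_nonneg (sub_nonneg.2 a.2) b.1
      have := mul_nonneg a.1 c.1
      linarith
    · have := mul_le_mul_of_nonneg_left b.2 (sub_nonneg.2 a.2)
      have := mul_le_mul_of_nonneg_left c.2 a.1
      linarith⟩, by fun_prop⟩
  have hP0 : ∀ s, P.curry s 0 = 0 := fun s => Subtype.ext (by simp [P, h0])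
  have hP1 : ∀ s, P.curry s 1 = 1 := fun s => Subtype.ext (by simp [P, h1])
  refine UPlus.homotopic_iff.2 ⟨⟨fun s => Stab.matMap (Susp.reparam (P.curry s) (hP0 s) (hP1 s)) k
    u.subOne, Mat.continuous_iff.2 fun i j => ?_⟩, fun s => u.isQuasiUnitary_subOne.map
      (Stab.matMap (Susp.reparam (P.curry s) (hP0 s) (hP1 s)) k), ?_, ?_⟩
  · refine continuous_induced_rng.2 ?_
    -- Each entry is `s ↦ f ∘ P(s, ·)`. It is norm-continuous since currying and postcomposition are
    -- continuous for the compact-open topology.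
    exact (ContinuousMap.continuous_postcomp
      ((u.subOne : CStarMatrix (Fin k) (Fin k) (Susp B)) i j).1).comp P.curry.continuous
  · rw [UPlus.subOne_map]
    have : P.curry 0 = p := ContinuousMap.ext fun t => Subtype.ext (by simp [P])
    simp only [ContinuousMap.coe_mk, this]
  · refine CStarMatrix.ext fun i j => Subtype.ext (ContinuousMap.ext fun t => ?_)
    refine congrArg ((u.subOne : CStarMatrix (Fin k) (Fin k) (Susp B)) i j).1
      (show P.curry 1 t = t from Subtype.ext (by simp [P]))

/-- The product of two unitaries over `ΣB` concatenated in the suspension coordinate. -/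
def UPlus.concat (u v : Σ k, UPlus (Susp B) k) : Σ k, UPlus (Susp B) k :=
  ⟨max u.1 v.1, .stab (le_max_left _ _) (u.2.map Susp.left) *
    .stab (le_max_right _ _) (v.2.map Susp.right)⟩

theorem KOne.cls_concat (u v : Σ k, UPlus (Susp B) k) :
    KOne.cls (UPlus.concat u v) = KOne.cls u + KOne.cls v := by
  rw [UPlus.concat, KOne.cls_mul, KOne.cls_stab, KOne.cls_stab]
  exact congrArg₂ _ (KOne.cls_eq_of_homotopic (UPlus.homotopic_map_reparam _ _ _ _))
    (KOne.cls_eq_of_homotopic (UPlus.homotopic_map_reparam _ _ _ _))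

theorem incl_subOne_stab_map {n : ℕ} (h : k ≤ n) (f : B →⋆ₙₐ[ℂ] C) (u : UPlus B k) :
    Stab.incl n (UPlus.stab h (u.map f)).subOne = Stab.map f (Stab.incl k u.subOne) := by
  rw [UPlus.subOne_stab, incl_padHom, UPlus.subOne_map, Stab.map_incl]

/-- In `(1 + a)(1 + b) - 1 = a + b + ab` the cross term vanishes because the two halves have
orthogonal ranges. The product of unitaries therefore realises the orthogonal sum that defines
concatenation. -/
theorem incl_subOne_concat (u v : Σ k, UPlus (Susp B) k) :
    Stab.incl _ (UPlus.concat u v).2.subOne = Stab.map Susp.left (Stab.incl u.1 u.2.subOne) +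
      Stab.map Susp.right (Stab.incl v.1 v.2.subOne) := by
  rw [UPlus.concat, UPlus.subOne_mul, map_add, map_add, map_mul, incl_subOne_stab_map,
    incl_subOne_stab_map, Stab.map_mul_map_eq_zero Susp.left_mul_right, add_zero]

theorem Stab.incl_injective : Function.Injective (Stab.incl (B := B) k) := by
  rw [injective_iff_map_eq_zero]
  intro x hx
  rw [← norm_eq_zero, ← Stab.norm_incl, hx, norm_zero]

/-- The group `K₁(ΣB)` is abelian. -/
theorem KOne.susp_add_comm (x y : KOne (Susp B)) : x + y = y + x := by
  obtain ⟨u, rfl⟩ := KOne.cls_surjective x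
  obtain ⟨v, rfl⟩ := KOne.cls_surjective y
  rw [← KOne.cls_concat]
  -- By orthogonality the two factors commute exactly, before any homotopy. This is the
  -- Eckmann–Hilton argument.
  have e : UPlus.concat u v = ⟨max u.1 v.1, .stab (le_max_right _ _) (v.2.map Susp.right) *
      .stab (le_max_left _ _) (u.2.map Susp.left)⟩ := by
    refine Sigma.ext rfl (heq_of_eq (UPlus.subOne_injective (Stab.incl_injective ?_)))
    refine (incl_subOne_concat u v).trans (Eq.symm ?_)
    change Stab.incl (max u.1 v.1) (UPlus.subOne (k := max u.1 v.1) (_ * _)) = _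
    rw [UPlus.subOne_mul, map_add, map_add, map_mul, incl_subOne_stab_map,
      incl_subOne_stab_map, Stab.map_mul_map_eq_zero Susp.right_mul_left, add_zero, add_comm]
  rw [e, KOne.cls_mul, KOne.cls_stab, KOne.cls_stab]
  exact congrArg₂ _ (KOne.cls_eq_of_homotopic (UPlus.homotopic_map_reparam _ _ _ _))
    (KOne.cls_eq_of_homotopic (UPlus.homotopic_map_reparam _ _ _ _))

theorem concat_omega {h h' : CircleSusp →⋆ₙₐ[ℂ] ADelta (Stab (Susp B))}
    {u v : ℕ → Σ k, UPlus (Susp B) k} (hu : h omega = subOneCls u) (hv : h' omega = subOneCls v) :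
    concat h h' omega = subOneCls fun n => UPlus.concat (u n) (v n) := by
  change ADelta.map _ (h omega) + ADelta.map _ (h' omega) = _
  rw [hu, hv]
  exact congrArg SeqAlg.cls (lp.ext (funext fun n => (incl_subOne_concat (u n) (v n)).symm))

end Suspension

/-! ### The map on sequences of `K₁` classes. -/

section Group

variable {B : Type*} [NonUnitalCStarAlgebra B]

/-- The map `([uₙ])ₙ ↦ [h]`, where `h(ω) = [n ↦ uₙ - 1]`, with its compatibility with
concatenation and its fibres. -/
theorem exists_map_of_unitaries : ∃ g : (ℕ → KOne (Susp B)) →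
      AsympClasses CircleSusp (Stab (Susp B)),
    (∀ (u : ℕ → Σ k, UPlus (Susp B) k) (h : CircleSusp →⋆ₙₐ[ℂ] ADelta (Stab (Susp B))),
      h omega = subOneCls u → g (fun n => KOne.cls (u n)) = AsympClasses.mk h) ∧
    Function.Surjective g ∧
    (∀ a b, g (a + b) = AsympClasses.concat (g a) (g b)) ∧
    g 0 = AsympClasses.mk 0 ∧
    ∀ a b, g a = g b ↔ ∀ᶠ n in atTop, a n = b n := by
  choose rep hrep using KOne.cls_surjective (B := Susp B)
  choose φ hφ using fun u : ℕ → Σ k, UPlus (Susp B) k =>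
    exists_starHom_omega (isQuasiUnitary_subOneCls u)
  -- Independence of the chosen representatives: `u` and the representatives of its classes agree in
  -- `K₁` for every `n`.
  have spec : ∀ (u : ℕ → Σ k, UPlus (Susp B) k)
      (h : CircleSusp →⋆ₙₐ[ℂ] ADelta (Stab (Susp B))), h omega = subOneCls u →
      AsympClasses.mk (φ fun n => rep (KOne.cls (u n))) = AsympClasses.mk h := fun u h hu =>
    Quotient.sound (asympHomotopic_of_cls_eq (.of_forall fun n => hrep _) (hφ _) hu)
  refine ⟨fun a => AsympClasses.mk (φ fun n => rep (a n)), spec, fun x => ?_, fun a b => ?_, ?_,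
    fun a b => ⟨fun hab => ?_, fun hab => ?_⟩⟩
  · obtain ⟨h, rfl⟩ := Quotient.exists_rep x
    obtain ⟨u, hu⟩ := exists_eq_subOneCls h
    exact ⟨fun n => KOne.cls (u n), spec u h hu⟩
  · rw [AsympClasses.concat_mk, ← spec _ _ (concat_omega (hφ fun n => rep (a n))
      (hφ fun n => rep (b n)))]
    simp only [KOne.cls_concat, hrep, Pi.add_apply]
  -- The zero homomorphism comes from the constant sequence of units in size `0`.
  · rw [← spec (fun _ => ⟨0, 1⟩) 0]
    · exact congrArg (fun a : ℕ → KOne (Susp B) => AsympClasses.mk (φ fun n => rep (a n)))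
        (funext fun _ => (KOne.cls_one 0).symm)
    · refine congrArg SeqAlg.cls (lp.ext (funext fun n => ?_))
      change 0 = Stab.incl 0 (UPlus.subOne 1)
      rw [UPlus.subOne_one, map_zero]
  · have := AsympHomotopic.eventually_cls_eq (Quotient.exact hab) (hφ _) (hφ _)
    simpa only [hrep] using this
  · exact Quotient.sound (asympHomotopic_of_cls_eq (by simpa only [hrep] using hab) (hφ _) (hφ _))

end Group

end DTheory

end

/-! ### The group of asymptotic classes and the kernel. -/

theorem mainTheorem2 {B : Type*} [NonUnitalCStarAlgebra B] :
    -- every sequence of unitaries `uₙ ∈ ⋃_k U_k⁺(ΣB)` determines a unique discrete asymptotic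
    -- homomorphism `h : Σ → 𝒜_δ(ΣB ⊗ 𝒦)` with `h(ω) = [n ↦ uₙ - 1]`
    (∀ u : ℕ → Σ k, UPlus (Susp B) k,
      ∃! h : CircleSusp →⋆ₙₐ[ℂ] ADelta (Stab (Susp B)), h omega = subOneCls u) ∧
    -- concatenation makes `[[Σ, ΣB ⊗ 𝒦]]_δ` an abelian group with neutral element `[0]`
    ∃ _ : AddCommGroup (AsympClasses CircleSusp (Stab (Susp B))),
      (∀ x y : AsympClasses CircleSusp (Stab (Susp B)), x + y = AsympClasses.concat x y) ∧
      AsympClasses.mk 0 = (0 : AsympClasses CircleSusp (Stab (Susp B))) ∧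
      -- the map `g_δ : ([uₙ])ₙ ↦ [h]` is well defined and is a surjective group homomorphism
      -- with kernel `⨁ₙ K₁(ΣB)`
      ∃ g : (ℕ → KOne (Susp B)) →+ AsympClasses CircleSusp (Stab (Susp B)),
        (∀ (u : ℕ → Σ k, UPlus (Susp B) k) (h : CircleSusp →⋆ₙₐ[ℂ] ADelta (Stab (Susp B))),
          h omega = subOneCls u → g (fun n => KOne.cls (u n)) = AsympClasses.mk h) ∧
        Function.Surjective g ∧
        g.ker = eventuallyZero (Susp B) := by
  refine ⟨fun u => ?_, ?_⟩
  · obtain ⟨h, hh⟩ := exists_starHom_omega (isQuasiUnitary_subOneCls u)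
    exact ⟨h, hh, fun h' hh' => starHom_ext_omega (hh'.trans hh.symm)⟩
  obtain ⟨g, hspec, hsurj, hadd, hzero, hker⟩ := exists_map_of_unitaries (B := B)
  choose r hr using hsurj
  -- Every axiom is checked on preimages `r x` under the surjection `g`, which turns sums into
  -- concatenations. Inverses are defined through the same section.
  let G : AddCommGroup (AsympClasses CircleSusp (Stab (Susp B))) :=
    { add := AsympClasses.concat
      zero := AsympClasses.mk 0
      neg := fun x => g (-r x)
      nsmul := @nsmulRec _ ⟨AsympClasses.mk 0⟩ ⟨AsympClasses.concat⟩
      zsmul := @zsmulRec _ ⟨AsympClasses.mk 0⟩ ⟨AsympClasses.concat⟩ ⟨fun x => g (-r x)⟩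
        (@nsmulRec _ ⟨AsympClasses.mk 0⟩ ⟨AsympClasses.concat⟩)
      add_assoc := fun x y z => by
        change AsympClasses.concat (AsympClasses.concat x y) z =
          AsympClasses.concat x (AsympClasses.concat y z)
        rw [← hr x, ← hr y, ← hr z, ← hadd, ← hadd, ← hadd, ← hadd, add_assoc]
      zero_add := fun x => by
        change AsympClasses.concat (AsympClasses.mk 0) x = x
        rw [← hr x, ← hzero, ← hadd, zero_add]
      add_zero := fun x => by
        change AsympClasses.concat x (AsympClasses.mk 0) = x
        rw [← hr x, ← hzero, ← hadd, add_zero]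
      neg_add_cancel := fun x => by
        change AsympClasses.concat (g (-r x)) x = AsympClasses.mk 0
        -- The first occurrence of `x` sits inside `r x` and must remain as it is.
        nth_rewrite 2 [← hr x]
        rw [← hadd, neg_add_cancel, hzero]
      add_comm := fun x y => by
        change AsympClasses.concat x y = AsympClasses.concat y x
        rw [← hr x, ← hr y, ← hadd, ← hadd]
        exact congrArg g (funext fun n => KOne.susp_add_comm _ _) }
  refine ⟨G, fun _ _ => rfl, rfl, ⟨⟨g, hzero⟩, hadd⟩, hspec, fun x => ⟨r x, hr x⟩, ?_⟩
  ext a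
  rw [AddMonoidHom.mem_ker]
  -- The kernel is the fibre through `g 0`, and fibres are classes of eventual equality.
  exact (show g a = AsympClasses.mk 0 ↔ _ by rw [← hzero, hker]; exact eventually_atTop)
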